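/- Let $\mathbb F$ be a field and $G$ an abelian group. Algebras are vector spaces over $\mathbb F$ with a bilinear multiplication (no associativity, unit or finite dimension is assumed). The centroid of an algebra $\mathcal A$ is $C(\mathcal A)=\{c\in\operatorname{End}_{\mathbb F}(\mathcal A)\mid c(xy)=c(x)y=xc(y)\ \forall x,y\}$, and $\mathcal A$ is central simple if $\mathcal A\neq 0$, $\mathcal A^2=\mathcal A$, its only ideals are $0$ and $\mathcal A$, and $C(\mathcal A)=\mathbb F1$. A $G$-graded algebra $\mathcal B=\bigoplus_{g\in G}\mathcal B_g$ (with $\mathcal B_g\mathcal B_h\subseteq\mathcal B_{gh}$) is graded-central-simple if $\mathcal B\ne 0$, $\mathcal B^2=\mathcal B$, its only graded ideals are $0$ and $\mathcal B$, and the only $c\in C(\mathcal B)$ with $c(\mathcal B_g)\subseteq\mathcal B_g$ for all $g\in G$ are the scalars. Write $\simeq_G$ for isomorphism of $G$-graded algebras (an algebra isomorphism mapping the component of degree $g$ onto the component of degree $g$, for all $g\in G$). For abelian groups $A,B$ let $\mathrm Z^2_{\mathrm{sym}}(A,B)$ be the group of symmetric $2$-cocycles, i.e. maps $\sigma:A\times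 A\to B$ with $\sigma(a,b)\sigma(ab,c)=\sigma(a,bc)\sigma(b,c)$ and $\sigma(a,b)=\sigma(b,a)$, and let $\mathrm H^2_{\mathrm{sym}}(A,B)=\mathrm Z^2_{\mathrm{sym}}(A,B)/\{\mathrm d\gamma\mid\gamma:A\to B\}$, where $\mathrm d\gamma(a,b)=\gamma(a)\gamma(b)\gamma(ab)^{-1}$; for a homomorphism $f:A'\to A$ put $f^*[\sigma]=[\sigma\circ(f\times f)]$. For a $G$-graded algebra $\mathcal A$ and $\tau\in\mathrm Z^2_{\mathrm{sym}}(G,\mathbb F^\times)$, the twist $\mathcal A^\tau$ is the graded vector space $\mathcal A$ with the multiplication $x*y=\tau(g,h)xy$ for $x\in\mathcal A_g$, $y\in\mathcal A_h$. For a subgroup $H\le G$ with projection $\pi:G\to G/H$ and a $G/H$-graded algebra $\mathcal A$, the loop algebra is the $G$-graded subalgebra $L_\pi(\mathcal A)=\bigoplus_{g\in G}\mathcal A_{\pi(g)}\otimes g$ of $\mathcal A\otimes_{\mathbb F}\mathbb FG$, and $L_\pi^\tau(\mathcal A)=(L_\pi(\mathcal A))^\tau$. Let $\overline{\mathfrak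 B}(G,\mathbb F)$ be the set of $\simeq_G$-isomorphism classes $[\mathcal B]$ of $G$-graded-central-simple algebras $\mathcal B$. Let $\overline{\mathfrak A}(G,\mathbb F)$ be the set of equivalence classes of triples $(H,[\tau],\mathcal A)$, where $H$ is a subgroup of $G$, $[\tau]\in\mathrm H^2_{\mathrm{sym}}(G,\mathbb F^\times)$, and $\mathcal A$ is a $G/H$-graded algebra that is central simple as an ungraded algebra, under the equivalence relation: $(H_1,[\tau_1],\mathcal A_1)\sim(H_2,[\tau_2],\mathcal A_2)$ if $H_1=H_2=:H$, $\iota^*[\tau_1]=\iota^*[\tau_2]$ for the inclusion $\iota:H\hookrightarrow G$, and there is $\mu\in\mathrm Z^2_{\mathrm{sym}}(G/H,\mathbb F^\times)$ such that $[\tau_1]=\pi^*([\mu])[\tau_2]$ and $\mathcal A_1^\mu\simeq_{G/H}\mathcal A_2$. Then the map $$\overline{\mathfrak A}(G,\mathbb F)\longrightarrow\overline{\mathfrak B}(G,\mathbb F),\qquad [(H,[\tau],\mathcal A)]\mapsto[L_\pi^\tau(\mathcal A)]$$ is well defined (in particular, $L_\pi^\tau(\mathcal A)$ is $G$-graded-central-simple)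 and is a bijection. -/

import Mathlib

universe u v w

open scoped TensorProduct

noncomputable section

/-! ## Symmetric second cohomology of abelian groups -/

section Cohomology

variable (A B : Type*) [CommGroup A] [CommGroup B]

/-- The group `Z²_sym(A, B)` of symmetric `2`-cocycles (trivial action), under pointwise product. -/
def Z2sym : Subgroup (A → A → B) where
  carrier := {σ | (∀ a b c, σ a b * σ (a * b) c = σ a (b * c) * σ b c) ∧ ∀ a b, σ a b = σ b a}
  one_mem' := by simp
  mul_mem' := by
    rintro σ τ ⟨hσ, hσ'⟩ ⟨hτ, hτ'⟩
    refine ⟨fun a b c => ?_, fun a b => ?_⟩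
    · simp only [Pi.mul_apply]
      rw [mul_mul_mul_comm, hσ, hτ, mul_mul_mul_comm]
    · simp only [Pi.mul_apply, hσ' a b, hτ' a b]
  inv_mem' := by
    rintro σ ⟨hσ, hσ'⟩
    refine ⟨fun a b c => ?_, fun a b => ?_⟩
    · simp only [Pi.inv_apply]
      rw [← mul_inv, ← mul_inv, hσ]
    · simp only [Pi.inv_apply, hσ' a b]

/-- The coboundary map `γ ↦ dγ`, `dγ(a, b) = γ(a) γ(b) γ(ab)⁻¹`. -/
def coboundaryHom : (A → B) →* (A → A → B) where
  toFun γ := fun a b => γ a * γ b * (γ (a * b))⁻¹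
  map_one' := by funext a b; simp
  map_mul' γ δ := by
    funext a b
    simp only [Pi.mul_apply, mul_inv]
    rw [mul_mul_mul_comm (γ a), mul_mul_mul_comm (γ a * γ b)]

/-- The group `B²(A, B)` of `2`-coboundaries. -/
def B2 : Subgroup (A → A → B) := (coboundaryHom A B).range

theorem B2_le_Z2sym : B2 A B ≤ Z2sym A B := by
  rintro _ ⟨γ, rfl⟩
  refine ⟨fun a b c => ?_, fun a b => ?_⟩
  · simp only [coboundaryHom, MonoidHom.coe_mk, OneHom.coe_mk]
    rw [← mul_assoc a b c]
    have e : ∀ {M : Type _} [AddCommGroup M] (p q r s t k : M),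
        p + q + -t + (t + r + -k) = p + s + -k + (q + r + -s) := by
      intros; abel
    exact e (M := Additive B) _ _ _ _ _ _
  · simp only [coboundaryHom, MonoidHom.coe_mk, OneHom.coe_mk]
    rw [mul_comm (γ a), mul_comm a]

/-- `H²_sym(A, B) = Z²_sym(A, B) / B²(A, B)`. -/
def H2sym : Type _ := Z2sym A B ⧸ (B2 A B).subgroupOf (Z2sym A B)

instance : CommGroup (H2sym A B) :=
  inferInstanceAs (CommGroup (Z2sym A B ⧸ (B2 A B).subgroupOf (Z2sym A B)))

variable {A B} in
/-- The class `[τ]` of a symmetric cocycle. -/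
def H2sym.mk : Z2sym A B →* H2sym A B := QuotientGroup.mk' _

variable {A}

/-- Precomposition of a symmetric cocycle with `f × f`. -/
def Z2sym.comap {A' : Type*} [CommGroup A'] (f : A' →* A) : Z2sym A B →* Z2sym A' B where
  toFun σ := ⟨fun a b => σ.1 (f a) (f b), fun a b c => by
      simpa only [map_mul] using σ.2.1 (f a) (f b) (f c), fun a b => σ.2.2 _ _⟩
  map_one' := rfl
  map_mul' _ _ := rfl

/-- The map `f^* : H²_sym(A, B) → H²_sym(A', B)`, `[σ] ↦ [σ ∘ (f × f)]`. -/
def H2sym.pullback {A' : Type*} [CommGroup A'] (f : A' →* A) : H2sym A B →* H2sym A' B :=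
  QuotientGroup.map _ _ (Z2sym.comap B f) (by
    rintro ⟨σ, hσ⟩ ⟨γ, hγ⟩
    refine ⟨fun a => γ (f a), ?_⟩
    change coboundaryHom A B γ = σ at hγ
    subst hγ
    funext a b
    change γ (f a) * γ (f b) * (γ (f (a * b)))⁻¹ = γ (f a) * γ (f b) * (γ (f a * f b))⁻¹
    rw [map_mul])

end Cohomology

/-! ## Graded algebras -/

open scoped Classical in
/-- A `G`-graded algebra over `F`: a vector space with a bilinear multiplication (not necessarily
associative, unital or finite-dimensional) which is the direct sum of subspaces `deg g`, `g ∈ G`,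
such that `deg g * deg h ⊆ deg (g * h)`. -/
structure GradedAlg (F : Type u) [Field F] (G : Type v) [CommGroup G] where
  carrier : Type w
  [addCommGroup : AddCommGroup carrier]
  [module : Module F carrier]
  mul : carrier →ₗ[F] carrier →ₗ[F] carrier
  deg : G → Submodule F carrier
  isInternal : DirectSum.IsInternal deg
  mul_mem : ∀ {g h : G} {x y : carrier}, x ∈ deg g → y ∈ deg h → mul x y ∈ deg (g * h)

attribute [instance] GradedAlg.addCommGroup GradedAlg.module

namespace GradedAlg

variable {F : Type u} [Field F] {G : Type v} [CommGroup G]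

/-- Graded isomorphism `A ≃_G B`. -/
def GradedIso (A B : GradedAlg.{u, v, w} F G) : Prop :=
  ∃ φ : A.carrier ≃ₗ[F] B.carrier,
    (∀ x y, φ (A.mul x y) = B.mul (φ x) (φ y)) ∧
      ∀ g, (A.deg g).map φ.toLinearMap = B.deg g

section Predicates

variable (A : GradedAlg.{u, v, w} F G)

/-- Two-sided ideals. -/
def IsIdeal (I : Submodule F A.carrier) : Prop :=
  ∀ a, ∀ x ∈ I, A.mul a x ∈ I ∧ A.mul x a ∈ I

/-- Graded ideals: ideals `I` with `I = ⊕ (I ∩ A_g)`. -/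
def IsGradedIdeal (I : Submodule F A.carrier) : Prop :=
  A.IsIdeal I ∧ I = ⨆ g, I ⊓ A.deg g

/-- The subspace `A²` spanned by all products. -/
def square : Submodule F A.carrier := Submodule.map₂ A.mul ⊤ ⊤

/-- `A` is simple as an ungraded algebra: `A ≠ 0`, `A² = A`, and the only ideals are `0`, `A`. -/
def IsSimple : Prop :=
  Nontrivial A.carrier ∧ A.square = ⊤ ∧ ∀ I, A.IsIdeal I → I = ⊥ ∨ I = ⊤

/-- `A` is graded-simple: `A ≠ 0`, `A² = A`, and the only graded ideals are `0`, `A`. -/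
def IsGradedSimple : Prop :=
  Nontrivial A.carrier ∧ A.square = ⊤ ∧ ∀ I, A.IsGradedIdeal I → I = ⊥ ∨ I = ⊤

/-- The centroid `C(A)`, a unital subalgebra of `End_F(A)`. -/
def centroid : Subalgebra F (Module.End F A.carrier) where
  carrier := {c | ∀ x y, c (A.mul x y) = A.mul (c x) y ∧ c (A.mul x y) = A.mul x (c y)}
  mul_mem' := by
    intro c d hc hd x y
    simp only [Module.End.mul_apply]
    exact ⟨by rw [(hd x y).1, (hc _ _).1], by rw [(hd x y).2, (hc _ _).2]⟩
  add_mem' := by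
    intro c d hc hd x y
    simp only [LinearMap.add_apply, map_add]
    exact ⟨by rw [(hd x y).1, (hc _ _).1], by rw [(hd x y).2, (hc _ _).2]⟩
  algebraMap_mem' r x y := by simp [Module.algebraMap_end_apply]

/-- The subspace `C(A)_g` of centroid elements that are homogeneous of degree `g`. -/
def centroidDeg (g : G) : Submodule F (Module.End F A.carrier) where
  carrier := {c | c ∈ A.centroid ∧ ∀ g', ∀ x ∈ A.deg g', c x ∈ A.deg (g * g')}
  zero_mem' := ⟨zero_mem _, fun _ _ _ => zero_mem _⟩
  add_mem' := fun hc hd =>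
    ⟨add_mem hc.1 hd.1, fun g' x hx => add_mem (hc.2 g' x hx) (hd.2 g' x hx)⟩
  smul_mem' := fun r _ hc =>
    ⟨A.centroid.smul_mem hc.1 r, fun g' x hx => Submodule.smul_mem _ r (hc.2 g' x hx)⟩

/-- `A` is central simple as an ungraded algebra: simple with `C(A) = F 1`. -/
def IsCentralSimple : Prop :=
  A.IsSimple ∧ Subalgebra.toSubmodule A.centroid = Submodule.span F {1}

/-- `A` is graded-central-simple: graded-simple with `C(A)_e = F 1`. -/
def IsGradedCentralSimple : Prop :=
  A.IsGradedSimple ∧ A.centroidDeg 1 = Submodule.span F {1}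

end Predicates

namespace GradedIso

theorem refl (A : GradedAlg.{u, v, w} F G) : A.GradedIso A :=
  ⟨LinearEquiv.refl F _, fun _ _ => rfl, fun _ => Submodule.map_id _⟩

theorem symm {A B : GradedAlg.{u, v, w} F G} : A.GradedIso B → B.GradedIso A := by
  rintro ⟨φ, hm, hd⟩
  refine ⟨φ.symm, fun x y => ?_, fun g => ?_⟩
  · rw [LinearEquiv.symm_apply_eq, hm, φ.apply_symm_apply, φ.apply_symm_apply]
  · rw [← hd g, ← Submodule.map_comp]
    simp

theorem trans {A B C : GradedAlg.{u, v, w} F G} :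
    A.GradedIso B → B.GradedIso C → A.GradedIso C := by
  rintro ⟨φ, hm, hd⟩ ⟨ψ, hm', hd'⟩
  refine ⟨φ.trans ψ, fun x y => ?_, fun g => ?_⟩
  · simp [hm, hm']
  · rw [← hd' g, ← hd g, ← Submodule.map_comp]
    rfl

end GradedIso

/-! ## Cocycle twists -/

section Twist

variable (A : GradedAlg.{u, v, w} F G)

open scoped Classical in
/-- The isomorphism of `A` with the external direct sum of its homogeneous components. -/
def coords : A.carrier ≃ₗ[F] DirectSum G (fun g => A.deg g) :=
  (LinearEquiv.ofBijective (DirectSum.coeLinearMap A.deg) A.isInternal).symm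

open scoped Classical in
/-- The bilinear map with `(x, y) ↦ τ(g, h) x y` for `x ∈ A_g`, `y ∈ A_h`. -/
def twistMul (τ : G → G → Fˣ) : A.carrier →ₗ[F] A.carrier →ₗ[F] A.carrier :=
  (DirectSum.toModule F G _ fun g =>
    ((DirectSum.toModule F G _ fun h =>
      ((τ g h : F) • A.mul.domRestrict₁₂ (A.deg g) (A.deg h)).flip).comp
        A.coords.toLinearMap).flip).comp A.coords.toLinearMap

theorem twistMul_of_mem (τ : G → G → Fˣ) {g h : G} {x y : A.carrier}
    (hx : x ∈ A.deg g) (hy : y ∈ A.deg h) :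
    A.twistMul τ x y = (τ g h : F) • A.mul x y := by
  classical
  have key : ∀ {g : G} {x : A.carrier} (hx : x ∈ A.deg g),
      A.coords x = DirectSum.lof F G (fun g => A.deg g) g ⟨x, hx⟩ := by
    intro g x hx
    rw [coords, LinearEquiv.symm_apply_eq]
    exact (DirectSum.coeLinearMap_lof A.deg g ⟨x, hx⟩).symm
  simp only [twistMul, LinearMap.comp_apply, LinearEquiv.coe_coe, key hx, key hy,
    DirectSum.toModule_lof, LinearMap.flip_apply, LinearMap.smul_apply]
  rfl

/-- The `τ`-twist `A^τ`: the same graded vector space, with multiplication `twistMul τ`. -/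
def twist (τ : Z2sym G Fˣ) : GradedAlg.{u, v, w} F G where
  carrier := A.carrier
  mul := A.twistMul τ.1
  deg := A.deg
  isInternal := A.isInternal
  mul_mem hx hy := by
    rw [A.twistMul_of_mem τ.1 hx hy]
    exact Submodule.smul_mem _ _ (A.mul_mem hx hy)

/-- Two bilinear maps that agree on homogeneous elements are equal. -/
theorem bilin_ext {V : Type*} [AddCommGroup V] [Module F V]
    {f f' : A.carrier →ₗ[F] A.carrier →ₗ[F] V}
    (hf : ∀ g h, ∀ x ∈ A.deg g, ∀ y ∈ A.deg h, f x y = f' x y) : f = f' := by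
  classical
  have htop : ⨆ g, A.deg g = ⊤ := A.isInternal.submodule_iSup_eq_top
  have hx : ∀ x : A.carrier, x ∈ ⨆ g, A.deg g := fun x => by rw [htop]; trivial
  ext x y
  refine Submodule.iSup_induction A.deg (motive := fun x => f x y = f' x y) (hx x) ?_ (by simp)
    (fun a b ha hb => by simp [ha, hb])
  intro g a ha
  refine Submodule.iSup_induction A.deg (motive := fun y => f a y = f' a y) (hx y) ?_ (by simp)
    (fun b c hb hc => by simp [hb, hc])
  exact fun h b hb => hf g h a ha b hb

end Twist

/-! ## Loop algebras -/

section Loop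

variable {H : Subgroup G} (A : GradedAlg.{u, v, w} F (G ⧸ H))

/-- The multiplication of the algebra `A ⊗ F G`. -/
def tensorMul : A.carrier ⊗[F] MonoidAlgebra F G →ₗ[F]
    A.carrier ⊗[F] MonoidAlgebra F G →ₗ[F] A.carrier ⊗[F] MonoidAlgebra F G :=
  TensorProduct.map₂ A.mul (LinearMap.mul F (MonoidAlgebra F G))

/-- The subspace `A_{π(g)} ⊗ g` of `A ⊗ F G`, where `π : G → G/H`. -/
def loopDeg (g : G) : Submodule F (A.carrier ⊗[F] MonoidAlgebra F G) :=
  (A.deg (QuotientGroup.mk' H g)).map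
    ((TensorProduct.mk F A.carrier (MonoidAlgebra F G)).flip (MonoidAlgebra.of F G g))

/-- The subspace `⊕_g A_{π(g)} ⊗ g` of `A ⊗ F G`. -/
def loopSpace : Submodule F (A.carrier ⊗[F] MonoidAlgebra F G) := ⨆ g, A.loopDeg g

theorem tensorMul_mem_loopDeg {g h : G} {x y : A.carrier ⊗[F] MonoidAlgebra F G}
    (hx : x ∈ A.loopDeg g) (hy : y ∈ A.loopDeg h) : A.tensorMul x y ∈ A.loopDeg (g * h) := by
  obtain ⟨a, ha, rfl⟩ := hx
  obtain ⟨b, hb, rfl⟩ := hy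
  refine ⟨A.mul a b, ?_, ?_⟩
  · rw [map_mul]
    exact A.mul_mem ha hb
  · simp [tensorMul]

theorem tensorMul_mem_loopSpace {x y : A.carrier ⊗[F] MonoidAlgebra F G}
    (hx : x ∈ A.loopSpace) (hy : y ∈ A.loopSpace) : A.tensorMul x y ∈ A.loopSpace := by
  refine Submodule.iSup_induction A.loopDeg (motive := fun x => A.tensorMul x y ∈ A.loopSpace)
    hx ?_ (by simp) (fun a b ha hb => by simpa using add_mem ha hb)
  intro g a ha
  refine Submodule.iSup_induction A.loopDeg (motive := fun y => A.tensorMul a y ∈ A.loopSpace)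
    hy ?_ (by simp) (fun b c hb hc => by simpa using add_mem hb hc)
  exact fun h b hb => Submodule.mem_iSup_of_mem (g * h) (A.tensorMul_mem_loopDeg ha hb)

theorem iSupIndep_loopDeg : iSupIndep A.loopDeg := by
  classical
  let p (g : G) : A.carrier ⊗[F] MonoidAlgebra F G →ₗ[F] A.carrier :=
    TensorProduct.rid F A.carrier ∘ₗ
      LinearMap.lTensor A.carrier
        (Finsupp.lapply g ∘ₗ (MonoidAlgebra.coeffLinearEquiv F).toLinearMap)
  have hp : ∀ g h a, p g (a ⊗ₜ MonoidAlgebra.of F G h) = if h = g then a else 0 := by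
    intro g h a
    simp [p, MonoidAlgebra.of_apply, Finsupp.single_apply]
  rw [iSupIndep_def]
  intro g
  rw [Submodule.disjoint_def]
  rintro _ ⟨a, -, rfl⟩ hx
  have hker : ⨆ h, ⨆ (_ : h ≠ g), A.loopDeg h ≤ LinearMap.ker (p g) := by
    refine iSup₂_le fun h hh => ?_
    rintro _ ⟨b, -, rfl⟩
    change p g (b ⊗ₜ MonoidAlgebra.of F G h) = 0
    rw [hp, if_neg hh]
  have h0 : p g (a ⊗ₜ MonoidAlgebra.of F G g) = 0 := hker hx
  rw [hp, if_pos rfl] at h0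
  simp [h0]

/-- The loop algebra `L_π(A)`, as a subalgebra of `A ⊗ F G`, with its `G`-grading. -/
def loop : GradedAlg.{u, v, max u v w} F G where
  carrier := A.loopSpace
  mul := LinearMap.mk₂ F (fun x y => ⟨A.tensorMul x y, A.tensorMul_mem_loopSpace x.2 y.2⟩)
    (fun _ _ _ => Subtype.ext (by simp)) (fun _ _ _ => Subtype.ext (by simp))
    (fun _ _ _ => Subtype.ext (by simp)) (fun _ _ _ => Subtype.ext (by simp))
  deg g := (A.loopDeg g).comap A.loopSpace.subtype
  isInternal := by
    classical
    have hle : ∀ g, A.loopDeg g ≤ A.loopSpace := le_iSup A.loopDeg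
    refine DirectSum.isInternal_submodule_of_iSupIndep_of_iSup_eq_top ?_ ?_
    · rw [iSupIndep_def]
      intro g
      rw [Submodule.disjoint_def]
      intro x hx hx'
      refine Subtype.ext ((Submodule.disjoint_def.1 (A.iSupIndep_loopDeg g)) x.1 hx ?_)
      have hle' : ⨆ h, ⨆ (_ : h ≠ g), (A.loopDeg h).comap A.loopSpace.subtype ≤
          (⨆ h, ⨆ (_ : h ≠ g), A.loopDeg h).comap A.loopSpace.subtype :=
        iSup₂_le fun h hh => Submodule.comap_mono (le_iSup₂_of_le h hh le_rfl)
      exact hle' hx'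
    · refine Submodule.map_injective_of_injective A.loopSpace.subtype_injective ?_
      rw [Submodule.map_iSup, Submodule.map_subtype_top]
      simp only [Submodule.map_comap_subtype, inf_eq_right.2 (hle _)]
      rfl
  mul_mem hx hy := A.tensorMul_mem_loopDeg hx hy

/-- The cocycle twisted loop algebra `L_π^τ(A) = (L_π(A))^τ`. -/
def twistedLoop (τ : Z2sym G Fˣ) : GradedAlg.{u, v, max u v w} F G := A.loop.twist τ

end Loop

section TwistIso

variable (A : GradedAlg.{u, v, w} F G)

theorem twist_one_iso : (A.twist 1).GradedIso A := by
  refine ⟨LinearEquiv.refl F _, ?_, fun _ => Submodule.map_id _⟩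
  have : A.twistMul (1 : Z2sym G Fˣ).1 = A.mul := A.bilin_ext fun g h x hx y hy => by
    rw [A.twistMul_of_mem _ hx hy]
    simp
  exact fun x y => LinearMap.congr_fun₂ this x y

theorem twist_mul_iso (σ τ : Z2sym G Fˣ) :
    (A.twist (σ * τ)).GradedIso ((A.twist σ).twist τ) := by
  refine ⟨LinearEquiv.refl F _, ?_, fun _ => Submodule.map_id _⟩
  have : A.twistMul (σ * τ).1 = (A.twist σ).twistMul τ.1 :=
    A.bilin_ext fun g h x hx y hy => by
      rw [A.twistMul_of_mem _ hx hy]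
      refine Eq.trans ?_ ((A.twist σ).twistMul_of_mem τ.1 hx hy).symm
      change _ = (τ.1 g h : F) • A.twistMul σ.1 x y
      rw [A.twistMul_of_mem _ hx hy, smul_smul, mul_comm]
      simp
  exact fun x y => LinearMap.congr_fun₂ this x y

variable {A} in
theorem GradedIso.twist {B : GradedAlg.{u, v, w} F G} (τ : Z2sym G Fˣ) :
    A.GradedIso B → (A.twist τ).GradedIso (B.twist τ) := by
  rintro ⟨φ, hm, hd⟩
  refine ⟨φ, ?_, hd⟩
  have hφ : ∀ {g x}, x ∈ A.deg g → φ x ∈ B.deg g := fun hx => by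
    rw [← hd]; exact Submodule.mem_map_of_mem hx
  have : (A.twistMul τ.1).compr₂ φ.toLinearMap =
      (B.twistMul τ.1).compl₁₂ φ.toLinearMap φ.toLinearMap :=
    A.bilin_ext fun g h x hx y hy => by
      simp only [LinearMap.compr₂_apply, LinearMap.compl₁₂_apply, LinearEquiv.coe_coe]
      rw [A.twistMul_of_mem _ hx hy, B.twistMul_of_mem _ (hφ hx) (hφ hy), map_smul, hm]
  exact fun x y => LinearMap.congr_fun₂ this x y

end TwistIso

end GradedAlg

/-! ## The two sets of classes -/

section Classes

variable (F : Type u) [Field F] (G : Type v) [CommGroup G]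

/-- Triples `(H, [τ], A)` with `H ≤ G`, `[τ] ∈ H²_sym(G, F^×)` and `A` a central simple and
`G/H`-graded algebra. -/
structure LoopTriple where
  H : Subgroup G
  τ : H2sym G Fˣ
  A : GradedAlg.{u, v, max u v w} F (G ⧸ H)
  centralSimple : A.IsCentralSimple

/-- `G`-graded-central-simple algebras. -/
structure GradedCentralSimpleAlg where
  B : GradedAlg.{u, v, max u v w} F G
  gradedCentralSimple : B.IsGradedCentralSimple

variable {F G}

/-- The relation `(H₁, [τ₁], A₁) ∼ (H₂, [τ₂], A₂)`: `H₁ = H₂ =: H`, `ι^*[τ₁] = ι^*[τ₂]`, and there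
is `μ ∈ Z²_sym(G/H, F^×)` with `[τ₁] = π^*[μ] [τ₂]` and `A₁^μ ≃ A₂` as `G/H`-graded algebras. -/
def LoopTriple.Rel (t₁ t₂ : LoopTriple.{u, v, w} F G) : Prop :=
  ∃ (H : Subgroup G) (τ₁ τ₂ : H2sym G Fˣ) (A₁ A₂ : GradedAlg.{u, v, max u v w} F (G ⧸ H))
    (h₁ : A₁.IsCentralSimple) (h₂ : A₂.IsCentralSimple),
    t₁ = ⟨H, τ₁, A₁, h₁⟩ ∧ t₂ = ⟨H, τ₂, A₂, h₂⟩ ∧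
    H2sym.pullback Fˣ H.subtype τ₁ = H2sym.pullback Fˣ H.subtype τ₂ ∧
    ∃ μ : Z2sym (G ⧸ H) Fˣ,
      τ₁ = H2sym.pullback Fˣ (QuotientGroup.mk' H) (H2sym.mk μ) * τ₂ ∧
      (A₁.twist μ).GradedIso A₂

theorem LoopTriple.rel_equivalence : Equivalence (LoopTriple.Rel.{u, v, w} (F := F) (G := G)) where
  refl t := ⟨t.H, t.τ, t.τ, t.A, t.A, t.centralSimple, t.centralSimple, rfl, rfl, rfl, 1, by
    rw [map_one, map_one, one_mul], t.A.twist_one_iso⟩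
  symm := by
    rintro _ _ ⟨H, τ₁, τ₂, A₁, A₂, h₁, h₂, rfl, rfl, hι, μ, hμ, hA⟩
    refine ⟨H, τ₂, τ₁, A₂, A₁, h₂, h₁, rfl, rfl, hι.symm, μ⁻¹, ?_, ?_⟩
    · rw [hμ, map_inv, map_inv, inv_mul_cancel_left]
    · refine (hA.symm.twist μ⁻¹).trans ((A₁.twist_mul_iso μ μ⁻¹).symm.trans ?_)
      rw [mul_inv_cancel]
      exact A₁.twist_one_iso
  trans := by
    rintro _ _ _ ⟨H, τ₁, τ₂, A₁, A₂, h₁, h₂, rfl, rfl, hι, μ, hμ, hA⟩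
      ⟨H', τ₂', τ₃, A₂', A₃, h₂', h₃, he, rfl, hι', ν, hν, hA'⟩
    cases he
    refine ⟨H, τ₁, τ₃, A₁, A₃, h₁, h₃, rfl, rfl, hι.trans hι', μ * ν, ?_, ?_⟩
    · rw [hμ, hν, map_mul, map_mul, mul_assoc]
    · exact (A₁.twist_mul_iso μ ν).trans ((hA.twist ν).trans hA')

variable (F G)

/-- The equivalence relation `∼` on triples. -/
def LoopTriple.setoid : Setoid (LoopTriple.{u, v, w} F G) := ⟨_, LoopTriple.rel_equivalence⟩

/-- Graded isomorphism of `G`-graded-central-simple algebras. -/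
def GradedCentralSimpleAlg.setoid : Setoid (GradedCentralSimpleAlg.{u, v, w} F G) :=
  ⟨fun B₁ B₂ => B₁.B.GradedIso B₂.B, fun B => .refl B.B, .symm, .trans⟩

/-- The set of equivalence classes of triples `(H, [τ], A)`. -/
def TripleClasses : Type _ := Quotient (LoopTriple.setoid.{u, v, w} F G)

/-- The set of isomorphism classes of `G`-graded-central-simple algebras. -/
def AlgClasses : Type _ := Quotient (GradedCentralSimpleAlg.setoid.{u, v, w} F G)

variable {F G}

/-- The class `[(H, [τ], A)]`. -/
def LoopTriple.toClass (t : LoopTriple.{u, v, w} F G) : TripleClasses.{u, v, w} F G :=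
  Quotient.mk _ t

/-- The class `[B]`. -/
def GradedCentralSimpleAlg.toClass (B : GradedCentralSimpleAlg.{u, v, w} F G) :
    AlgClasses.{u, v, w} F G :=
  Quotient.mk _ B

end Classes

end

-- A loop algebra remembers its base through the centroid. If `P : B → A` is multiplicative and
-- restricts to isomorphisms `B_g ≃ A_{π(g)}` (`IsCover`), then `H` acts on `B` by deck
-- transformations, which are homogeneous elements of the centroid. Conversely, an action of `H` by
-- centroid elements of matching degrees has a quotient `A` covered by `B` (`exists_isCover`).
-- Central simplicity of `A` corresponds to graded-central-simplicity of `B` with centroid supported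
-- on `H`. The hard point is `IsGradedSimple.isSimple`, where a minimal-support argument turns a
-- non-graded ideal into a centroid element of nontrivial degree.
--
-- Surjectivity: in a graded-central-simple `B`, nonzero homogeneous centroid elements are
-- invertible (Schur) and each degree contributes at most a line, so they span a commutative twisted
-- group algebra of the support `H`, with a symmetric factor set σ. Divisible groups being
-- injective, σ extends to `G` up to a coboundary (`Z2sym.exists_extension`). Twisting `B` by the
-- inverse of this extension τ gives an honest action of `H`, so the twist is a loop algebra, and
-- twisting back by τ recovers `B`.
--
-- Injectivity: `H` is the support of the centroid. An isomorphism of twisted loop algebras matches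
-- the two deck actions up to scalars `m(h)`, so τ₁/τ₂ restricts to `dm` on `H`. By
-- `Z2sym.exists_inflation`, τ₁/τ₂ = dγ · π^*μ with γ extending `m`, and rescaling by γ makes the
-- isomorphism descend to `A₁^μ ≃ A₂`. Well-definedness is the same computation read backwards.

universe x y

noncomputable section

/-! ## Extension and descent of symmetric cocycles -/

section Cocycle

/-- The abelian extension of `A` by `B` defined by a symmetric cocycle. -/
structure CocycleExt {A B : Type*} [CommGroup A] [CommGroup B] (σ : Z2sym A B) where
  base : A
  fib : B

namespace Z2sym

variable {A B : Type*} [CommGroup A] [CommGroup B] (σ : Z2sym A B)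

theorem cocycle (a b c : A) : σ.1 a b * σ.1 (a * b) c = σ.1 a (b * c) * σ.1 b c :=
  σ.2.1 a b c

theorem symm (a b : A) : σ.1 a b = σ.1 b a := σ.2.2 a b

theorem one_left (a : A) : σ.1 1 a = σ.1 1 1 := by
  have h := Z2sym.cocycle σ 1 1 a
  rw [one_mul, one_mul] at h
  exact (mul_right_cancel h).symm

theorem one_right (a : A) : σ.1 a 1 = σ.1 1 1 := by
  rw [Z2sym.symm σ, Z2sym.one_left σ]

end Z2sym

/-! ### The abelian extension with a given symmetric factor set -/

namespace CocycleExt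

variable {A B : Type*} [CommGroup A] [CommGroup B] {σ : Z2sym A B}

theorem ext' {x y : CocycleExt σ} (h : x.base = y.base) (h' : x.fib = y.fib) : x = y := by
  cases x; cases y; cases h; cases h'; rfl

instance : Mul (CocycleExt σ) := ⟨fun x y => ⟨x.base * y.base, x.fib * y.fib * σ.1 x.base y.base⟩⟩
-- Cocycles need not be normalized; the factor σ(1,1)⁻¹ makes this element neutral, and `incl`
-- carries the same correction.
instance : One (CocycleExt σ) := ⟨⟨1, (σ.1 1 1)⁻¹⟩⟩
instance : Inv (CocycleExt σ) :=
  ⟨fun x => ⟨x.base⁻¹, (σ.1 1 1 * x.fib * σ.1 x.base⁻¹ x.base)⁻¹⟩⟩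

theorem base_mul (x y : CocycleExt σ) : (x * y).base = x.base * y.base := rfl
theorem fib_mul (x y : CocycleExt σ) : (x * y).fib = x.fib * y.fib * σ.1 x.base y.base := rfl
theorem base_one : (1 : CocycleExt σ).base = 1 := rfl
theorem fib_one : (1 : CocycleExt σ).fib = (σ.1 1 1)⁻¹ := rfl
theorem base_inv (x : CocycleExt σ) : x⁻¹.base = x.base⁻¹ := rfl
theorem fib_inv (x : CocycleExt σ) : x⁻¹.fib = (σ.1 1 1 * x.fib * σ.1 x.base⁻¹ x.base)⁻¹ := rfl

/-- Associativity is the cocycle identity and commutativity the symmetry of σ. Being abelian, the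
extension is subject to the injectivity of divisible groups. -/
instance : CommGroup (CocycleExt σ) where
  mul_assoc x y z := by
    refine ext' (mul_assoc _ _ _) ?_
    simp only [fib_mul, base_mul]
    calc x.fib * y.fib * σ.1 x.base y.base * z.fib * σ.1 (x.base * y.base) z.base
        = x.fib * y.fib * z.fib * (σ.1 x.base y.base * σ.1 (x.base * y.base) z.base) := by
          rw [mul_right_comm _ _ z.fib]; simp only [mul_assoc]
      _ = _ := by
          rw [Z2sym.cocycle σ, mul_comm (σ.1 x.base _)]; simp only [mul_assoc]
  one_mul x := by
    refine ext' (one_mul _) ?_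
    rw [fib_mul, fib_one, base_one, Z2sym.one_left σ x.base, mul_right_comm, inv_mul_cancel, one_mul]
  mul_one x := by
    refine ext' (mul_one _) ?_
    rw [fib_mul, fib_one, base_one, Z2sym.one_right σ x.base, mul_assoc, inv_mul_cancel, mul_one]
  inv_mul_cancel x := by
    refine ext' (inv_mul_cancel _) ?_
    rw [fib_mul, fib_inv, base_inv, fib_one, mul_inv, mul_inv, mul_assoc, mul_assoc,
      mul_mul_mul_comm]
    simp
  mul_comm x y := by
    refine ext' (mul_comm _ _) ?_
    rw [fib_mul, fib_mul, mul_comm x.fib, Z2sym.symm σ]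

/-- The inclusion of the kernel. -/
def incl (σ : Z2sym A B) : B →* CocycleExt σ where
  toFun b := ⟨1, b * (σ.1 1 1)⁻¹⟩
  map_one' := ext' rfl (one_mul _)
  map_mul' a b := by
    refine ext' (one_mul _).symm ?_
    rw [fib_mul]
    change a * b * (σ.1 1 1)⁻¹ = a * (σ.1 1 1)⁻¹ * (b * (σ.1 1 1)⁻¹) * σ.1 1 1
    rw [← mul_assoc, inv_mul_cancel_right, mul_right_comm]

theorem incl_injective (σ : Z2sym A B) : Function.Injective (incl σ) := fun a b h => by
  have := congrArg CocycleExt.fib h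
  exact mul_right_cancel this

/-- The section `a ↦ (a, 1)` has factor set σ, so any homomorphism out of the extension turns σ into
a coboundary. -/
theorem mk_one_mul_mk_one (a b : A) :
    (⟨a, 1⟩ * ⟨b, 1⟩ : CocycleExt σ) = incl σ (σ.1 a b) * ⟨a * b, 1⟩ := by
  refine ext' (one_mul _).symm ?_
  rw [fib_mul, fib_mul]
  change 1 * 1 * σ.1 a b = σ.1 a b * (σ.1 1 1)⁻¹ * 1 * σ.1 1 (a * b)
  rw [Z2sym.one_left σ (a * b), mul_one, mul_one, one_mul, inv_mul_cancel_right]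

end CocycleExt

/-- Every abelian group embeds in a divisible one. -/
theorem exists_divisible_embedding (M : Type u) [AddCommGroup M] :
    ∃ (D : Type u) (_ : AddCommGroup D) (_ : DivisibleBy D ℤ) (j : M →+ D),
      Function.Injective j := by
  -- Evaluation maps `M` to a power of ℚ/ℤ; it is injective because characters separate points.
  refine ⟨CharacterModule M → AddCircle (1 : ℚ), inferInstance, inferInstance,
    ⟨⟨fun m c => c m, by ext; simp⟩, fun a b => by ext; simp⟩, ?_⟩
  rw [injective_iff_map_eq_zero]
  intro m hm
  by_contra hne
  obtain ⟨c, hc⟩ := CharacterModule.exists_character_apply_ne_zero_of_ne_zero hne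
  exact hc (congrFun hm c)

/-- Restriction of symmetric cohomology classes to a subgroup is surjective. -/
theorem Z2sym.exists_extension {G : Type v} {M : Type u} [CommGroup G] [CommGroup M]
    (H : Subgroup G) (σ : Z2sym H M) :
    ∃ (τ : Z2sym G M) (m : H → M), ∀ h k : H,
      τ.1 h k = σ.1 h k * (m h * m k * (m (h * k))⁻¹) := by
  obtain ⟨D, _, _, j, hj⟩ := exists_divisible_embedding (Additive M)
  -- Injectivity of `D` extends `j` from the kernel `M` to the whole extension. Along the section, ψ
  -- gives a cochain `e` with `de = j ∘ σ`.
  obtain ⟨ψ, hψ⟩ := (Module.Baer.of_divisible D).extension_property_addMonoidHom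
    (MonoidHom.toAdditive (CocycleExt.incl σ)) (CocycleExt.incl_injective σ) j
  have hψ' : ∀ b : M, ψ (Additive.ofMul (CocycleExt.incl σ b)) = j (Additive.ofMul b) :=
    fun b => DFunLike.congr_fun hψ (Additive.ofMul b)
  let e : H → D := fun h => ψ (Additive.ofMul (⟨h, 1⟩ : CocycleExt σ))
  have he : ∀ h k : H, e h + e k = j (Additive.ofMul (σ.1 h k)) + e (h * k) := by
    intro h k
    rw [← hψ']
    simp only [e]
    rw [← map_add ψ, ← map_add ψ, ← ofMul_mul, ← ofMul_mul, CocycleExt.mk_one_mul_mk_one]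
  let Q := D ⧸ j.range
  let q : D →+ Q := QuotientAddGroup.mk' j.range
  have hq0 : ∀ m, q (j m) = 0 := fun m =>
    (QuotientAddGroup.eq_zero_iff _).2 ⟨m, rfl⟩
  -- Modulo `j(M)` the cochain `e` is a homomorphism, and the quotient `Q` is again divisible, so it
  -- extends to `G`.
  let θ₀ : Additive H →+ Q := AddMonoidHom.mk' (fun h => q (e h.toMul)) fun h k => by
    rw [← map_add q, he, map_add q, hq0, zero_add, toMul_add]
  let _ : DivisibleBy Q ℤ := Function.Surjective.divisibleBy q
    (QuotientAddGroup.mk'_surjective _) fun a n => map_zsmul q n a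
  obtain ⟨θ, hθ⟩ := (Module.Baer.of_divisible Q).extension_property_addMonoidHom
    (MonoidHom.toAdditive H.subtype) H.subtype_injective θ₀
  have hqs : Function.Surjective q := QuotientAddGroup.mk'_surjective _
  -- For a set-theoretic lift `t` of θ, the coboundary `dt` takes values in `j(M)`; this is τ. On
  -- `H` both `t` and `e` lift θ₀, so `t - e` also lands in `j(M)`; this is `m`.
  choose t ht using fun g : G => hqs (θ (Additive.ofMul g))
  have hmem : ∀ x : D, q x = 0 → ∃ m : M, j (Additive.ofMul m) = x := fun x hx =>
    (QuotientAddGroup.eq_zero_iff _).1 hx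
  have hτ : ∀ g k : G, ∃ m : M, j (Additive.ofMul m) = t g + t k - t (g * k) := fun g k =>
    hmem _ (by rw [map_sub, map_add, ht, ht, ht, ofMul_mul, map_add, sub_self])
  choose τ hτ using hτ
  have hm : ∀ h : H, ∃ m : M, j (Additive.ofMul m) = t h - e h := fun h =>
    hmem _ (by
      rw [map_sub, ht, sub_eq_zero]
      exact DFunLike.congr_fun hθ (Additive.ofMul h))
  choose m hm using hm
  have hinj : ∀ a b : M, j (Additive.ofMul a) = j (Additive.ofMul b) → a = b :=
    fun a b h => Additive.ofMul.injective (hj h)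
  refine ⟨⟨τ, fun a b c => hinj _ _ ?_, fun a b => hinj _ _ ?_⟩, m, fun h k => hinj _ _ ?_⟩
  · rw [ofMul_mul, ofMul_mul, map_add, map_add, hτ, hτ, hτ, hτ, mul_assoc]
    abel
  · rw [hτ, hτ, mul_comm, add_comm (t a)]
  · have h1 := hm h
    have h2 := hm k
    have h3 := hm (h * k)
    have h4 := he h k
    have h5 : j (Additive.ofMul (σ.1 h k)) = e h + e k - e (h * k) := by rw [h4]; abel
    rw [ofMul_mul, ofMul_mul, ofMul_mul, ofMul_inv, map_add, map_add, map_add, map_neg, h1, h2,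
      h3, h5]
    change j (Additive.ofMul (τ h k)) = _
    rw [hτ]
    push_cast
    abel

/-- A symmetric cocycle which restricts to the coboundary `dm` on `H` is the product of a
coboundary `dγ` with `γ` extending `m`, and of a cocycle inflated from `G ⧸ H`. -/
theorem Z2sym.exists_inflation {G : Type v} {M : Type u} [CommGroup G] [CommGroup M]
    (H : Subgroup G) (τ : Z2sym G M) (m : H → M)
    (hm : ∀ h k : H, τ.1 h k = m h * m k * (m (h * k))⁻¹) :
    ∃ (γ : G → M) (μ : Z2sym (G ⧸ H) M), (∀ h : H, γ h = m h) ∧ (∀ q, μ.1 1 q = 1) ∧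
      ∀ g k : G, τ.1 g k = γ g * γ k * (γ (g * k))⁻¹ * μ.1 g k := by
  classical
  -- The section is normalized at 1, which gives γ = m on `H` and `μ(1, q) = 1`.
  let s : G ⧸ H → G := fun q => if q = 1 then 1 else q.out
  have hs1 : s 1 = 1 := if_pos rfl
  have hs : ∀ q, (s q : G ⧸ H) = q := fun q => by
    by_cases h : q = 1
    · rw [h, hs1]; rfl
    · simp only [s, if_neg h]; exact q.out_eq'
  have hmem : ∀ g : G, (s g)⁻¹ * g ∈ H := fun g => QuotientGroup.eq.1 (hs g)
  let r : G → H := fun g => ⟨_, hmem g⟩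
  have hr : ∀ g : G, s g * r g = g := fun g => mul_inv_cancel_left _ _
  have hsH : ∀ h : H, s ((h : G) : G ⧸ H) = 1 := fun h => by
    rw [(QuotientGroup.eq_one_iff (h : G)).2 h.2, hs1]
  have hrH : ∀ h : H, r h = h := fun h => Subtype.ext (by
    change (s ((h : G) : G ⧸ H))⁻¹ * h = h
    rw [hsH, inv_one, one_mul])
  have hm1 : m 1 = τ.1 1 1 := by
    have := hm 1 1
    rw [mul_one, mul_inv_cancel_right] at this
    exact this.symm
  -- With γ(s(q)) = τ(1,1), this value is forced by requiring τ/dγ to be trivial on the pairs (s(q),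
  -- h).
  let γ : G → M := fun g => m (r g) * (τ.1 (s g) (r g))⁻¹ * τ.1 1 1
  have hγH : ∀ h : H, γ h = m h := fun h => by
    simp only [γ, hrH, hsH, Z2sym.one_left τ, inv_mul_cancel_right]
  let dγ : Z2sym G M := ⟨coboundaryHom G M γ, B2_le_Z2sym G M ⟨γ, rfl⟩⟩
  let ρ : Z2sym G M := τ * dγ⁻¹
  have hρ : ∀ g k, ρ.1 g k = τ.1 g k * (γ g * γ k * (γ (g * k))⁻¹)⁻¹ := fun g k => rfl
  have hρH : ∀ h k : H, ρ.1 h k = 1 := fun h k => by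
    rw [hρ, hγH, hγH, ← Subgroup.coe_mul, hγH, hm, mul_inv_cancel]
  have hss : ∀ q, s ((s q : G) : G ⧸ H) = s q := fun q => by rw [hs]
  have hrs : ∀ q, r (s q) = 1 := fun q => Subtype.ext (by
    change (s ((s q : G) : G ⧸ H))⁻¹ * s q = 1
    rw [hss, inv_mul_cancel])
  have hcoset : ∀ (g : G) (h : H), ((g * h : G) : G ⧸ H) = g := fun g h => by
    rw [QuotientGroup.eq]; simp
  have hρs : ∀ q (h : H), ρ.1 (s q) h = 1 := by
    intro q h
    have h1 : s ((s q * h : G) : G ⧸ H) = s q := by rw [hcoset, hs]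
    have h2 : r (s q * h) = h := Subtype.ext (by
      change (s ((s q * h : G) : G ⧸ H))⁻¹ * (s q * h) = h
      rw [h1, inv_mul_cancel_left])
    have h3 : γ (s q) = τ.1 1 1 := by
      simp only [γ, hrs, hss, hm1, Subgroup.coe_one, Z2sym.one_right τ, mul_inv_cancel, one_mul]
    have h4 : γ (s q * h) = m h * (τ.1 (s q) h)⁻¹ * τ.1 1 1 := by
      simp only [γ, h1, h2]
    rw [hρ, hγH, h3, h4, mul_inv_eq_one, eq_mul_inv_iff_mul_eq, mul_comm (m h), mul_assoc,
      mul_inv_cancel_left, mul_comm]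
  -- The cocycle identity at (s(g), r(g), h) spreads triviality from representatives to all of `G`;
  -- applied once more it makes ρ invariant under `H`, so that ρ lives on `G ⧸ H`.
  have hρG : ∀ g (h : H), ρ.1 g h = 1 := fun g h => by
    have := Z2sym.cocycle ρ (s g) (r g) h
    rw [hρs, hr, one_mul, ← Subgroup.coe_mul, hρs, hρH, mul_one] at this
    exact this
  have hinv : ∀ g k (h : H), ρ.1 g (k * h) = ρ.1 g k := fun g k h => by
    have := Z2sym.cocycle ρ g k h
    rw [hρG, hρG, mul_one, mul_one] at this
    exact this.symm
  have hinv' : ∀ g k, ρ.1 g k = ρ.1 (s g) (s k) := fun g k => by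
    conv_lhs => rw [← hr k, hinv, Z2sym.symm ρ, ← hr g, hinv, Z2sym.symm ρ]
  refine ⟨γ, ⟨fun p q => ρ.1 (s p) (s q), fun a b c => ?_, fun a b => Z2sym.symm ρ _ _⟩, hγH,
    fun q => ?_, fun g k => ?_⟩
  · have h1 : ρ.1 (s (a * b)) (s c) = ρ.1 (s a * s b) (s c) := by
      rw [hinv' (s a * s b), hss, QuotientGroup.mk_mul, hs, hs]
    have h2 : ρ.1 (s a) (s (b * c)) = ρ.1 (s a) (s b * s c) := by
      rw [hinv' (s a) (s b * s c), hss, QuotientGroup.mk_mul, hs, hs]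
    change ρ.1 _ _ * ρ.1 _ _ = ρ.1 _ _ * ρ.1 _ _
    rw [h1, h2, Z2sym.cocycle ρ]
  · change ρ.1 (s 1) (s q) = 1
    rw [hs1, Z2sym.symm ρ]
    exact hρG _ 1
  · change _ = _ * ρ.1 (s g) (s k)
    rw [← hinv', hρ, mul_comm, inv_mul_cancel_right]

end Cocycle

namespace GradedAlg

variable {F : Type u} [Field F] {G : Type v} [CommGroup G]

/-! ## Homogeneous components -/

section Components

variable (A : GradedAlg.{u, v, w} F G)

open scoped Classical in
theorem coords_of_mem {g : G} {x : A.carrier} (hx : x ∈ A.deg g) :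
    A.coords x = DirectSum.lof F G (fun g => A.deg g) g ⟨x, hx⟩ := by
  rw [coords, LinearEquiv.symm_apply_eq]
  exact (DirectSum.coeLinearMap_lof A.deg g ⟨x, hx⟩).symm

open scoped Classical in
/-- The linear map with prescribed restrictions to the homogeneous components. -/
def glift {V : Type*} [AddCommGroup V] [Module F V] (f : ∀ g, A.deg g →ₗ[F] V) :
    A.carrier →ₗ[F] V :=
  (DirectSum.toModule F G V f).comp A.coords.toLinearMap

theorem glift_of_mem {V : Type*} [AddCommGroup V] [Module F V] (f : ∀ g, A.deg g →ₗ[F] V)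
    {g : G} {x : A.carrier} (hx : x ∈ A.deg g) : A.glift f x = f g ⟨x, hx⟩ := by
  classical
  rw [glift, LinearMap.comp_apply, LinearEquiv.coe_coe, coords_of_mem A hx]
  exact DirectSum.toModule_lof F g _

theorem hom_induction {p : A.carrier → Prop} (zero : p 0) (add : ∀ x y, p x → p y → p (x + y))
    (hom : ∀ g, ∀ x ∈ A.deg g, p x) (x : A.carrier) : p x := by
  have hx : x ∈ ⨆ g, A.deg g := by
    classical
    rw [A.isInternal.submodule_iSup_eq_top]; trivial
  exact Submodule.iSup_induction A.deg (motive := p) hx hom zero add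

variable {A} in
theorem linear_ext {V : Type*} [AddCommGroup V] [Module F V] {f f' : A.carrier →ₗ[F] V}
    (h : ∀ g, ∀ x ∈ A.deg g, f x = f' x) : f = f' :=
  LinearMap.ext fun x => A.hom_induction (p := fun x => f x = f' x) (by simp)
    (fun x y hx hy => by rw [map_add, map_add, hx, hy]) h x

open scoped Classical in
/-- The projection to the component of degree `g`. -/
def proj (g : G) : A.carrier →ₗ[F] A.carrier :=
  A.glift fun k => if k = g then (A.deg k).subtype else 0

theorem proj_of_mem {g : G} {x : A.carrier} (hx : x ∈ A.deg g) : A.proj g x = x := by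
  rw [proj, A.glift_of_mem _ hx, if_pos rfl]; rfl

theorem proj_of_mem_ne {g k : G} {x : A.carrier} (hx : x ∈ A.deg k) (h : k ≠ g) :
    A.proj g x = 0 := by
  rw [proj, A.glift_of_mem _ hx, if_neg h]; rfl

theorem proj_mem (g : G) (x : A.carrier) : A.proj g x ∈ A.deg g := by
  refine A.hom_induction (p := fun x => A.proj g x ∈ A.deg g) (by simp)
    (fun x y hx hy => by rw [map_add]; exact add_mem hx hy) (fun k x hx => ?_) x
  by_cases h : k = g
  · subst h; rwa [A.proj_of_mem hx]
  · rw [A.proj_of_mem_ne hx h]; exact zero_mem _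

theorem exists_finset_sum_proj (x : A.carrier) :
    ∃ s : Finset G, (∀ g ∉ s, A.proj g x = 0) ∧ x = ∑ g ∈ s, A.proj g x := by
  classical
  -- Asking for all finite sets containing `s` makes the claim stable under sums, whereas exact
  -- supports may shrink by cancellation.
  have key : ∀ x : A.carrier, ∃ s : Finset G, ∀ t, s ⊆ t →
      (∀ g ∉ t, A.proj g x = 0) ∧ x = ∑ g ∈ t, A.proj g x := by
    refine A.hom_induction ⟨∅, by simp⟩ ?_ ?_
    · rintro x y ⟨s, hs⟩ ⟨t, ht⟩
      refine ⟨s ∪ t, fun r hr => ?_⟩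
      have h1 := hs r (Finset.union_subset_left hr)
      have h2 := ht r (Finset.union_subset_right hr)
      refine ⟨fun g hg => by rw [map_add, h1.1 g hg, h2.1 g hg, add_zero], ?_⟩
      simp only [map_add, Finset.sum_add_distrib]
      rw [← h1.2, ← h2.2]
    · intro k x hx
      refine ⟨{k}, fun t ht => ⟨fun g hg => A.proj_of_mem_ne hx ?_, ?_⟩⟩
      · rintro rfl; exact hg (ht (Finset.mem_singleton_self _))
      · rw [Finset.sum_eq_single_of_mem k (ht (Finset.mem_singleton_self _)), A.proj_of_mem hx]
        exact fun g _ hg => A.proj_of_mem_ne hx hg.symm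
  obtain ⟨s, hs⟩ := key x
  exact ⟨s, hs s subset_rfl⟩

variable {A} in
theorem eq_zero_of_proj {x : A.carrier} (h : ∀ g, A.proj g x = 0) : x = 0 := by
  obtain ⟨s, -, hs⟩ := A.exists_finset_sum_proj x
  rw [hs]; exact Finset.sum_eq_zero fun g _ => h g

theorem finite_support (x : A.carrier) : {g | A.proj g x ≠ 0}.Finite := by
  obtain ⟨s, hs, -⟩ := A.exists_finset_sum_proj x
  exact s.finite_toSet.subset fun g hg => by_contra fun h => hg (hs g h)

variable {A} in
theorem eq_zero_of_mem_of_mem {g k : G} {x : A.carrier} (hg : x ∈ A.deg g) (hk : x ∈ A.deg k)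
    (h : g ≠ k) : x = 0 := by
  rw [← A.proj_of_mem hg, A.proj_of_mem_ne hk h.symm]

/-- Multiplications by homogeneous elements, homogeneous centroid elements and graded homomorphisms
(`g = 1`) are all covered. -/
theorem proj_apply_of_shift {A' : GradedAlg.{u, v, w} F G} {f : A.carrier →ₗ[F] A'.carrier} {g : G}
    (hf : ∀ k, ∀ x ∈ A.deg k, f x ∈ A'.deg (g * k)) (k : G) (x : A.carrier) :
    A'.proj (g * k) (f x) = f (A.proj k x) := by
  refine A.hom_induction (p := fun x => A'.proj (g * k) (f x) = f (A.proj k x)) (by simp)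
    (fun x y hx hy => by simp only [map_add, hx, hy]) (fun l x hx => ?_) x
  by_cases h : l = k
  · subst h; rw [A'.proj_of_mem (hf _ _ hx), A.proj_of_mem hx]
  · rw [A'.proj_of_mem_ne (hf _ _ hx) (by simpa using h), A.proj_of_mem_ne hx h, map_zero]

theorem proj_mul_right {k : G} {b : A.carrier} (hb : b ∈ A.deg k) (g : G) (x : A.carrier) :
    A.proj (g * k) (A.mul x b) = A.mul (A.proj g x) b := by
  rw [mul_comm]
  refine proj_apply_of_shift A (A' := A) (f := A.mul.flip b) (fun l y hy => ?_) g x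
  rw [mul_comm]; exact A.mul_mem hy hb

theorem proj_mul_left {k : G} {b : A.carrier} (hb : b ∈ A.deg k) (g : G) (x : A.carrier) :
    A.proj (g * k) (A.mul b x) = A.mul b (A.proj g x) := by
  rw [mul_comm]
  exact proj_apply_of_shift A (A' := A) (f := A.mul b) (fun l y hy => A.mul_mem hb hy) g x

theorem bilin_mem_of_homogeneous {V : Type*} [AddCommGroup V] [Module F V]
    {f : A.carrier →ₗ[F] A.carrier →ₗ[F] V} {W : Submodule F V}
    (hf : ∀ g h, ∀ x ∈ A.deg g, ∀ y ∈ A.deg h, f x y ∈ W) (x y : A.carrier) : f x y ∈ W := by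
  refine A.hom_induction (p := fun x => f x y ∈ W) (by simp)
    (fun a b ha hb => by simpa using add_mem ha hb) (fun g x hx => ?_) x
  exact A.hom_induction (p := fun y => f x y ∈ W) (by simp)
    (fun a b ha hb => by simpa using add_mem ha hb) (fun h y hy => hf g h x hx y hy) y

theorem bijective_of_components {A' : GradedAlg.{u, v, w} F G} {f : A.carrier →ₗ[F] A'.carrier}
    (hf : ∀ k, ∀ x ∈ A.deg k, f x ∈ A'.deg k) (hinj : ∀ k, ∀ x ∈ A.deg k, f x = 0 → x = 0)
    (hsurj : ∀ k, ∀ y ∈ A'.deg k, ∃ x ∈ A.deg k, f x = y) : Function.Bijective f := by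
  constructor
  · rw [injective_iff_map_eq_zero]
    intro x hx
    refine eq_zero_of_proj fun k => hinj k _ (A.proj_mem k x) ?_
    rw [← proj_apply_of_shift A (A' := A') (g := 1) (by simpa using hf), hx, map_zero]
  · rw [← LinearMap.range_eq_top, eq_top_iff]
    intro y _
    exact A'.hom_induction (p := fun y => y ∈ LinearMap.range f) (zero_mem _)
      (fun _ _ => add_mem) (fun k y hy => (hsurj k y hy).imp fun _ h => h.2) y

theorem gradedIso_of_components {A' : GradedAlg.{u, v, w} F G} (f : A.carrier →ₗ[F] A'.carrier)
    (hmul : ∀ k l, ∀ x ∈ A.deg k, ∀ y ∈ A.deg l, f (A.mul x y) = A'.mul (f x) (f y))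
    (hf : ∀ k, ∀ x ∈ A.deg k, f x ∈ A'.deg k) (hinj : ∀ k, ∀ x ∈ A.deg k, f x = 0 → x = 0)
    (hsurj : ∀ k, ∀ y ∈ A'.deg k, ∃ x ∈ A.deg k, f x = y) : A.GradedIso A' := by
  refine ⟨LinearEquiv.ofBijective f (A.bijective_of_components hf hinj hsurj), fun x y => ?_,
    fun g => le_antisymm ?_ ?_⟩
  · have : A.mul.compr₂ f = A'.mul.compl₁₂ f f := A.bilin_ext hmul
    exact LinearMap.congr_fun₂ this x y
  · rintro _ ⟨x, hx, rfl⟩; exact hf g x hx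
  · intro y hy
    obtain ⟨x, hx, rfl⟩ := hsurj g y hy
    exact ⟨x, hx, rfl⟩

end Components

/-! ## Graded ideals -/

section Ideals

variable (A : GradedAlg.{u, v, w} F G)

/-- The family of homogeneous components of a graded ideal. -/
def IsIdealFamily (S : G → Submodule F A.carrier) : Prop :=
  (∀ g, S g ≤ A.deg g) ∧ ∀ g k, ∀ x ∈ S g, ∀ y ∈ A.deg k,
    A.mul x y ∈ S (g * k) ∧ A.mul y x ∈ S (g * k)

variable {A} {S : G → Submodule F A.carrier}

theorem IsIdealFamily.isGradedIdeal (hS : A.IsIdealFamily S) : A.IsGradedIdeal (⨆ g, S g) := by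
  refine ⟨fun a x hx => ?_, le_antisymm ?_ (iSup_le fun g => inf_le_left)⟩
  · refine A.hom_induction (p := fun a => A.mul a x ∈ ⨆ g, S g ∧ A.mul x a ∈ ⨆ g, S g) (by simp)
      (fun a b ha hb => by
        simp only [map_add, LinearMap.add_apply]
        exact ⟨add_mem ha.1 hb.1, add_mem ha.2 hb.2⟩) (fun k a ha => ?_) a
    refine Submodule.iSup_induction S
      (motive := fun x => A.mul a x ∈ ⨆ g, S g ∧ A.mul x a ∈ ⨆ g, S g) hx (fun g x hx => ?_)
      (by simp) (fun y z hy hz => by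
        simp only [map_add, LinearMap.add_apply]
        exact ⟨add_mem hy.1 hz.1, add_mem hy.2 hz.2⟩)
    exact ⟨Submodule.mem_iSup_of_mem _ (hS.2 g k x hx a ha).2,
      Submodule.mem_iSup_of_mem _ (hS.2 g k x hx a ha).1⟩
  · exact iSup_mono fun g => le_inf (le_iSup S g) (hS.1 g)

theorem IsIdealFamily.mem_of_mem_iSup (hS : A.IsIdealFamily S) {g : G} {x : A.carrier}
    (hx : x ∈ ⨆ g, S g) (hg : x ∈ A.deg g) : x ∈ S g := by
  rw [← A.proj_of_mem hg]
  refine Submodule.iSup_induction S (motive := fun x => A.proj g x ∈ S g) hx (fun k y hy => ?_)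
    (by simp) (fun y z hy hz => by rw [map_add]; exact add_mem hy hz)
  by_cases h : k = g
  · subst h; rwa [A.proj_of_mem (hS.1 _ hy)]
  · rw [A.proj_of_mem_ne (hS.1 _ hy) h]; exact zero_mem _

theorem IsGradedSimple.family (hA : A.IsGradedSimple) (hS : A.IsIdealFamily S) :
    (∀ g, S g = ⊥) ∨ ∀ g, S g = A.deg g := by
  rcases hA.2.2 _ hS.isGradedIdeal with h | h
  · exact Or.inl fun g => le_bot_iff.1 (h ▸ le_iSup S g)
  · exact Or.inr fun g => le_antisymm (hS.1 g) fun x hx => hS.mem_of_mem_iSup (h ▸ trivial) hx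

theorem isIdealFamily_inf {I : Submodule F A.carrier} (hI : A.IsIdeal I) :
    A.IsIdealFamily fun g => I ⊓ A.deg g :=
  ⟨fun _ => inf_le_right, fun _ _ x hx y hy =>
    ⟨⟨(hI y x hx.1).2, A.mul_mem hx.2 hy⟩,
      (hI y x hx.1).1, by rw [mul_comm]; exact A.mul_mem hy hx.2⟩⟩

theorem eq_top_of_deg_le {I : Submodule F A.carrier} (h : ∀ g, A.deg g ≤ I) : I = ⊤ :=
  eq_top_iff.2 fun x _ => A.hom_induction (p := fun x => x ∈ I) (zero_mem _)
    (fun _ _ => add_mem) (fun g _ hx => h g hx) x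

theorem isGradedSimple_of_family (h0 : Nontrivial A.carrier) (hsq : A.square = ⊤)
    (h : ∀ S, A.IsIdealFamily S → (∀ g, S g = ⊥) ∨ ∀ g, A.deg g ≤ S g) : A.IsGradedSimple := by
  refine ⟨h0, hsq, fun I hI => ?_⟩
  rcases h _ (isIdealFamily_inf hI.1) with h | h
  · left; rw [hI.2]; simp [h]
  · exact Or.inr (eq_top_of_deg_le fun g => (h g).trans inf_le_left)

/-- When `A² = A`, a linear map is determined by its values on products, where centroid elements can
be moved between the factors. -/
theorem square_ext (hA : A.square = ⊤) {V : Type*} [AddCommGroup V] [Module F V]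
    {f f' : A.carrier →ₗ[F] V}
    (h : ∀ g k, ∀ x ∈ A.deg g, ∀ y ∈ A.deg k, f (A.mul x y) = f' (A.mul x y)) : f = f' := by
  have h1 : A.mul.compr₂ f = A.mul.compr₂ f' := A.bilin_ext h
  have h2 : A.square ≤ LinearMap.eqLocus f f' := Submodule.map₂_le.2 fun x _ y _ =>
    LinearMap.congr_fun₂ h1 x y
  exact LinearMap.ext fun x => h2 (hA ▸ trivial)

theorem mul_mem_square (x y : A.carrier) : A.mul x y ∈ A.square :=
  Submodule.apply_mem_map₂ _ trivial trivial

/-- Homogeneous elements of the annihilator of a graded-simple algebra vanish. -/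
theorem IsGradedSimple.eq_zero_of_annihilates (hA : A.IsGradedSimple) {g : G} {x : A.carrier}
    (hx : x ∈ A.deg g) (h : ∀ k, ∀ y ∈ A.deg k, A.mul x y = 0 ∧ A.mul y x = 0) : x = 0 := by
  classical
  -- The line through `x` is a graded ideal. If it were all of `A`, every product would vanish,
  -- against `A² = A ≠ 0`.
  let S : G → Submodule F A.carrier := fun k => if k = g then Submodule.span F {x} else ⊥
  have hSx : ∀ k, S k ≤ Submodule.span F {x} := fun k => by
    by_cases hk : k = g
    · simp [S, hk]
    · simp [S, hk]
  have hz : ∀ z ∈ Submodule.span F {x}, ∀ k, ∀ y ∈ A.deg k, A.mul z y = 0 ∧ A.mul y z = 0 := by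
    intro z hz k y hy
    obtain ⟨r, rfl⟩ := Submodule.mem_span_singleton.1 hz
    simp [h k y hy]
  have hS : A.IsIdealFamily S := by
    refine ⟨fun k => ?_, fun k l z hzS y hy => ?_⟩
    · by_cases hk : k = g
      · simp [S, hk, hx]
      · simp [S, hk]
    · rw [(hz z (hSx k hzS) l y hy).1, (hz z (hSx k hzS) l y hy).2]
      exact ⟨zero_mem _, zero_mem _⟩
  rcases hA.family hS with hb | ht
  · have := hb g
    simpa [S] using this
  · exfalso
    have h0 : (LinearMap.id : A.carrier →ₗ[F] A.carrier) = 0 := square_ext hA.2.1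
      fun k l a ha b hb => by
        rw [LinearMap.id_apply, LinearMap.zero_apply]
        exact (hz a (hSx k (ht k ▸ ha)) l b hb).1
    obtain ⟨a, ha⟩ := @exists_ne _ hA.1 (0 : A.carrier)
    exact ha (LinearMap.congr_fun h0 a)

end Ideals

/-! ## The graded centroid -/

section Centroid

variable {A : GradedAlg.{u, v, w} F G}

theorem mem_centroidDeg_of {g : G} {c : Module.End F A.carrier}
    (hdeg : ∀ k, ∀ x ∈ A.deg k, c x ∈ A.deg (g * k))
    (hmul : ∀ k l, ∀ x ∈ A.deg k, ∀ y ∈ A.deg l,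
      c (A.mul x y) = A.mul (c x) y ∧ c (A.mul x y) = A.mul x (c y)) : c ∈ A.centroidDeg g := by
  refine ⟨fun x y => ⟨?_, ?_⟩, hdeg⟩
  · have : A.mul.compr₂ c = A.mul.comp c :=
      A.bilin_ext fun k l x hx y hy => (hmul k l x hx y hy).1
    exact LinearMap.congr_fun₂ this x y
  · have : A.mul.compr₂ c = A.mul.compl₂ c :=
      A.bilin_ext fun k l x hx y hy => (hmul k l x hx y hy).2
    exact LinearMap.congr_fun₂ this x y

theorem one_mem_centroidDeg : (1 : Module.End F A.carrier) ∈ A.centroidDeg 1 :=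
  ⟨one_mem _, fun g' x hx => by rwa [one_mul]⟩

theorem mul_mem_centroidDeg {g k : G} {c d : Module.End F A.carrier} (hc : c ∈ A.centroidDeg g)
    (hd : d ∈ A.centroidDeg k) : c * d ∈ A.centroidDeg (g * k) :=
  ⟨A.centroid.mul_mem hc.1 hd.1, fun l x hx => by rw [mul_assoc]; exact hc.2 _ _ (hd.2 _ _ hx)⟩

/-- Both composites send `xy` to `c(x)d(y)`. -/
theorem centroid_mul_comm (hA : A.square = ⊤) {c d : Module.End F A.carrier} (hc : c ∈ A.centroid)
    (hd : d ∈ A.centroid) : c * d = d * c :=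
  square_ext hA fun g k x _ y _ => by
    rw [Module.End.mul_apply, Module.End.mul_apply, (hd x y).2, (hc x _).1, (hc x y).1, (hd _ y).2]

theorem exists_apply_ne_zero {V : Type*} [AddCommGroup V] [Module F V] {c : A.carrier →ₗ[F] V}
    (hc : c ≠ 0) : ∃ k, ∃ x ∈ A.deg k, c x ≠ 0 := by
  by_contra! h
  exact hc (linear_ext fun k x hx => h k x hx)

/-- Schur's lemma: the homogeneous parts of the kernel and of the image of `c` form ideal families.
-/
theorem IsGradedSimple.bijective_of_ne_zero (hA : A.IsGradedSimple) {g : G}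
    {c : Module.End F A.carrier} (hc : c ∈ A.centroidDeg g) (h0 : c ≠ 0) :
    Function.Bijective c := by
  obtain ⟨k₀, x₀, hx₀, hcx₀⟩ := exists_apply_ne_zero h0
  constructor
  · have hI : A.IsIdeal (LinearMap.ker c) := fun a x hx => by
      have hx' : c x = 0 := hx
      constructor
      · change c _ = 0; rw [(hc.1 a x).2, hx', map_zero]
      · change c _ = 0; rw [(hc.1 x a).1, hx', map_zero, LinearMap.zero_apply]
    rcases hA.family (isIdealFamily_inf hI) with h | h
    · rw [injective_iff_map_eq_zero]
      intro x hx
      refine eq_zero_of_proj fun k => ?_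
      have h1 : A.proj k x ∈ LinearMap.ker c ⊓ A.deg k :=
        ⟨by
          change c _ = 0
          rw [← proj_apply_of_shift A (A' := A) hc.2, hx, map_zero], A.proj_mem k x⟩
      rw [h k] at h1
      exact h1
    · have h1 : x₀ ∈ LinearMap.ker c ⊓ A.deg k₀ := by rw [h k₀]; exact hx₀
      exact absurd h1.1 hcx₀
  · have hS : A.IsIdealFamily fun k => (A.deg (g⁻¹ * k)).map c := by
      refine ⟨fun k => ?_, fun k l z hz y hy => ?_⟩
      · rintro _ ⟨x, hx, rfl⟩
        simpa using hc.2 _ x hx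
      · obtain ⟨x, hx, rfl⟩ := hz
        constructor
        · exact ⟨A.mul x y, by rw [← mul_assoc]; exact A.mul_mem hx hy, (hc.1 x y).1⟩
        · exact ⟨A.mul y x, by rw [← mul_assoc, mul_comm]; exact A.mul_mem hy hx, (hc.1 y x).2⟩
    rcases hA.family hS with h | h
    · have h1 : c x₀ ∈ (A.deg (g⁻¹ * (g * k₀))).map c := ⟨x₀, by simpa using hx₀, rfl⟩
      rw [h] at h1
      exact absurd h1 hcx₀
    · rw [← LinearMap.range_eq_top]
      exact eq_top_of_deg_le fun k => (h k).symm.le.trans LinearMap.map_le_range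

theorem IsGradedSimple.exists_inverse (hA : A.IsGradedSimple) {g : G}
    {c : Module.End F A.carrier} (hc : c ∈ A.centroidDeg g) (h0 : c ≠ 0) :
    ∃ d ∈ A.centroidDeg g⁻¹, c * d = 1 ∧ d * c = 1 := by
  let e := LinearEquiv.ofBijective c (hA.bijective_of_ne_zero hc h0)
  have he : ∀ x, c (e.symm x) = x := e.apply_symm_apply
  have hinj := (hA.bijective_of_ne_zero hc h0).1
  refine ⟨e.symm.toLinearMap, ⟨fun x y => ⟨hinj ?_, hinj ?_⟩, fun k x hx => ?_⟩,
    LinearMap.ext he, LinearMap.ext e.symm_apply_apply⟩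
  · simp only [LinearEquiv.coe_coe]; rw [he, (hc.1 _ y).1, he]
  · simp only [LinearEquiv.coe_coe]; rw [he, (hc.1 x _).2, he]
  · have h1 : c (A.proj (g⁻¹ * k) (e.symm x)) = x := by
      rw [← proj_apply_of_shift A (A' := A) hc.2, mul_inv_cancel_left, he, A.proj_of_mem hx]
    have h2 : e.symm x = A.proj (g⁻¹ * k) (e.symm x) := hinj (by rw [h1, he])
    simp only [LinearEquiv.coe_coe]
    rw [h2]
    exact A.proj_mem _ _

/-- The product `d⁻¹c` has degree 1, hence is a scalar: each homogeneous component of the centroid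
is at most a line. -/
theorem IsGradedCentralSimple.exists_eq_smul (hA : A.IsGradedCentralSimple) {g : G}
    {c d : Module.End F A.carrier} (hc : c ∈ A.centroidDeg g) (hd : d ∈ A.centroidDeg g)
    (h0 : d ≠ 0) : ∃ r : F, c = r • d := by
  obtain ⟨e, he, hde, -⟩ := hA.1.exists_inverse hd h0
  have h1 := mul_mem_centroidDeg he hc
  rw [inv_mul_cancel, hA.2] at h1
  obtain ⟨r, hr⟩ := Submodule.mem_span_singleton.1 h1
  refine ⟨r, ?_⟩
  rw [← one_mul c, ← hde, mul_assoc, ← hr, mul_smul_comm, mul_one]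

theorem IsGradedSimple.one_ne_zero (hA : A.IsGradedSimple) : (1 : Module.End F A.carrier) ≠ 0 := by
  obtain ⟨x, hx⟩ := @exists_ne _ hA.1 (0 : A.carrier)
  exact fun h => hx (LinearMap.congr_fun h x)

theorem IsGradedSimple.mul_ne_zero (hA : A.IsGradedSimple) {g : G} {c d : Module.End F A.carrier}
    (hc : c ∈ A.centroidDeg g) (hc0 : c ≠ 0) (hd0 : d ≠ 0) :
    c * d ≠ 0 := by
  obtain ⟨e, -, -, he⟩ := hA.exists_inverse hc hc0
  intro h
  apply hd0
  rw [← one_mul d, ← he, mul_assoc, h, mul_zero]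

/-- The support of the centroid of a graded-simple algebra. -/
def centroidSupport (hA : A.IsGradedSimple) : Subgroup G where
  carrier := {g | A.centroidDeg g ≠ ⊥}
  one_mem' := (Submodule.ne_bot_iff _).2 ⟨1, one_mem_centroidDeg, hA.one_ne_zero⟩
  mul_mem' := by
    intro g k hg hk
    obtain ⟨c, hc, hc0⟩ := (Submodule.ne_bot_iff _).1 hg
    obtain ⟨d, hd, hd0⟩ := (Submodule.ne_bot_iff _).1 hk
    exact (Submodule.ne_bot_iff _).2
      ⟨c * d, mul_mem_centroidDeg hc hd, hA.mul_ne_zero hc hc0 hd0⟩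
  inv_mem' := by
    intro g hg
    obtain ⟨c, hc, hc0⟩ := (Submodule.ne_bot_iff _).1 hg
    obtain ⟨d, hd, hcd, -⟩ := hA.exists_inverse hc hc0
    refine (Submodule.ne_bot_iff _).2 ⟨d, hd, ?_⟩
    rintro rfl
    exact hA.one_ne_zero (by rw [← hcd, mul_zero])

end Centroid

/-! ## Twists -/

section TwistLemmas

variable {A : GradedAlg.{u, v, w} F G}

/-- `e` identifies `B` with the twist of `A` by `τ`. -/
structure IsTwist (τ : Z2sym G Fˣ) (A : GradedAlg.{u, v, w} F G) (B : GradedAlg.{u, v, x} F G)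
    (e : A.carrier ≃ₗ[F] B.carrier) : Prop where
  mem_iff : ∀ g x, e x ∈ B.deg g ↔ x ∈ A.deg g
  mul_of_mem : ∀ g k, ∀ x ∈ A.deg g, ∀ y ∈ A.deg k,
    B.mul (e x) (e y) = (τ.1 g k : F) • e (A.mul x y)

variable (A) in
/-- The identity map from an algebra to its twist. -/
def toTwist (τ : Z2sym G Fˣ) : A.carrier ≃ₗ[F] (A.twist τ).carrier := LinearEquiv.refl F A.carrier

variable (A) in
theorem isTwist_toTwist (τ : Z2sym G Fˣ) : IsTwist τ A (A.twist τ) (A.toTwist τ) :=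
  ⟨fun _ _ => Iff.rfl, fun _ _ _ hx _ hy => A.twistMul_of_mem τ.1 hx hy⟩

theorem GradedIso.exists_isTwist {B : GradedAlg.{u, v, w} F G} (h : A.GradedIso B) :
    ∃ e, IsTwist 1 A B e := by
  obtain ⟨e, hm, hd⟩ := h
  refine ⟨e, fun g x => ?_, fun g k x _ y _ => ?_⟩
  · rw [← hd]
    exact ⟨fun ⟨y, hy, h⟩ => e.injective h ▸ hy, fun hx => ⟨x, hx, rfl⟩⟩
  · rw [← hm]; simp

namespace IsTwist

variable {B : GradedAlg.{u, v, x} F G} {C : GradedAlg.{u, v, y} F G} {σ τ : Z2sym G Fˣ}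
  {e : A.carrier ≃ₗ[F] B.carrier} {f : B.carrier ≃ₗ[F] C.carrier}

theorem mem (h : IsTwist τ A B e) {g : G} {x : A.carrier} (hx : x ∈ A.deg g) : e x ∈ B.deg g :=
  (h.mem_iff g x).2 hx

theorem symm_mem (h : IsTwist τ A B e) {g : G} {x : B.carrier} (hx : x ∈ B.deg g) :
    e.symm x ∈ A.deg g := by
  rwa [← h.mem_iff, e.apply_symm_apply]

theorem symm (h : IsTwist τ A B e) : IsTwist τ⁻¹ B A e.symm := by
  refine ⟨fun g x => ?_, fun g k x hx y hy => ?_⟩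
  · rw [← h.mem_iff, e.apply_symm_apply]
  · apply e.injective
    have := h.mul_of_mem g k _ (h.symm_mem hx) _ (h.symm_mem hy)
    rw [e.apply_symm_apply, e.apply_symm_apply] at this
    rw [map_smul, e.apply_symm_apply, this, smul_smul]
    have h1 : ((τ⁻¹ : Z2sym G Fˣ).1 g k : F) * (τ.1 g k : F) = 1 := (τ.1 g k).inv_mul
    rw [h1, one_smul]

theorem trans (h : IsTwist σ A B e) (h' : IsTwist τ B C f) : IsTwist (σ * τ) A C (e.trans f) := by
  refine ⟨fun g x => ?_, fun g k x hx y hy => ?_⟩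
  · rw [LinearEquiv.trans_apply, h'.mem_iff, h.mem_iff]
  · simp only [LinearEquiv.trans_apply]
    rw [h'.mul_of_mem g k _ (h.mem hx) _ (h.mem hy), h.mul_of_mem g k x hx y hy, map_smul,
      smul_smul, mul_comm, ← Units.val_mul]
    rfl

theorem gradedIso {B : GradedAlg.{u, v, w} F G} {e : A.carrier ≃ₗ[F] B.carrier}
    (h : IsTwist 1 A B e) : A.GradedIso B := by
  refine gradedIso_of_components A e.toLinearMap (fun k l x hx y hy => ?_) (fun k x hx => h.mem hx)
    (fun k x hx h0 => e.map_eq_zero_iff.1 h0)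
    fun k y hy => ⟨e.symm y, h.symm_mem hy, e.apply_symm_apply y⟩
  have := h.mul_of_mem k l x hx y hy
  simp only [OneMemClass.coe_one, Pi.one_apply, Units.val_one, one_smul] at this
  exact this.symm

/-- Twists by cohomologous cocycles are isomorphic. -/
theorem of_coboundary (he : IsTwist σ A B e) (γ : G → Fˣ)
    (h : ∀ g k, σ.1 g k = γ g * γ k * (γ (g * k))⁻¹ * τ.1 g k) : ∃ f, IsTwist τ A B f := by
  let a (δ : G → Fˣ) : A.carrier →ₗ[F] A.carrier :=
    A.glift fun k => (δ k : F) • (A.deg k).subtype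
  have ha : ∀ δ k, ∀ x ∈ A.deg k, a δ x = (δ k : F) • x := fun δ k x hx => A.glift_of_mem _ hx
  have ha' : ∀ δ k, ∀ x ∈ A.deg k, a δ x ∈ A.deg k := fun δ k x hx => by
    rw [ha δ k x hx]; exact Submodule.smul_mem _ _ hx
  have hab : ∀ δ, a δ ∘ₗ a δ⁻¹ = LinearMap.id := fun δ => linear_ext fun k x hx => by
    rw [LinearMap.comp_apply, ha δ k _ (ha' _ k x hx), ha _ k x hx, smul_smul, Pi.inv_apply,
      Units.mul_inv, one_smul, LinearMap.id_apply]
  -- Scaling degree `k` by γ(k)⁻¹ before applying `e` removes the coboundary from the factor set.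
  let c : A.carrier ≃ₗ[F] A.carrier :=
    LinearEquiv.ofLinearMap (a γ⁻¹) (a γ) (by simpa using hab γ⁻¹) (hab γ)
  have hc : ∀ k, ∀ x ∈ A.deg k, c x = (((γ k)⁻¹ : Fˣ) : F) • x := fun k x hx => ha γ⁻¹ k x hx
  refine ⟨c.trans e, fun g x => ?_, fun g k x hx y hy => ?_⟩
  · rw [LinearEquiv.trans_apply, he.mem_iff]
    refine ⟨fun hx => ?_, fun hx => ha' _ _ _ hx⟩
    rw [← c.symm_apply_apply x]
    exact ha' γ _ _ hx
  · simp only [LinearEquiv.trans_apply]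
    rw [hc g x hx, hc k y hy, hc _ _ (A.mul_mem hx hy)]
    simp only [map_smul, LinearMap.smul_apply]
    rw [he.mul_of_mem g k x hx y hy, h]
    simp only [smul_smul, ← Units.val_mul]
    congr 2
    rw [eq_comm, ← mul_inv_eq_one]
    have key : ∀ {M : Type _} [AddCommGroup M] (p q r t : M),
        t + -r + -(-q + (-p + (p + q + -r + t))) = 0 := by intros; abel
    exact key (M := Additive Fˣ) (γ g) (γ k) (γ (g * k)) (τ.1 g k)

/-- Products of homogeneous elements change only by nonzero scalars, so both algebras have the same
graded ideals. -/
theorem isIdealFamily (h : IsTwist τ A B e) {S : G → Submodule F B.carrier}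
    (hS : B.IsIdealFamily S) : A.IsIdealFamily fun g => (S g).comap e.toLinearMap := by
  refine ⟨fun g x hx => (h.mem_iff g x).1 (hS.1 g hx), fun g k x hx y hy => ?_⟩
  have hx' : x ∈ A.deg g := (h.mem_iff g x).1 (hS.1 g hx)
  have h1 := hS.2 g k _ hx _ (h.mem hy)
  rw [LinearEquiv.coe_coe, h.mul_of_mem g k x hx' y hy, h.mul_of_mem k g y hy x hx'] at h1
  exact ⟨((S (g * k)).smul_mem_iff (τ.1 g k).ne_zero).1 h1.1,
    ((S (g * k)).smul_mem_iff (τ.1 k g).ne_zero).1 h1.2⟩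

theorem isGradedSimple (h : IsTwist τ A B e) (hA : A.IsGradedSimple) : B.IsGradedSimple := by
  refine isGradedSimple_of_family ?_ ?_ fun S hS => ?_
  · have := hA.1
    exact e.symm.toEquiv.nontrivial
  · have h1 : A.square ≤ B.square.comap e.toLinearMap := Submodule.map₂_le.2 fun x _ y _ => by
      refine A.bilin_mem_of_homogeneous (fun g k x hx y hy => ?_) x y
      refine (B.square.smul_mem_iff (τ.1 g k).ne_zero).1 ?_
      rw [LinearEquiv.coe_coe, ← h.mul_of_mem g k x hx y hy]
      exact mul_mem_square _ _
    rw [hA.2.1] at h1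
    refine eq_top_iff.2 fun x _ => ?_
    have := h1 (Submodule.mem_top (x := e.symm x))
    rwa [Submodule.mem_comap, LinearEquiv.coe_coe, e.apply_symm_apply] at this
  · rcases hA.family (h.isIdealFamily hS) with h1 | h1
    · refine Or.inl fun g => (Submodule.eq_bot_iff _).2 fun x hx => ?_
      have h2 : e.symm x ∈ (S g).comap e.toLinearMap := by
        rwa [Submodule.mem_comap, LinearEquiv.coe_coe, e.apply_symm_apply]
      rw [h1 g] at h2
      exact e.symm.map_eq_zero_iff.1 h2
    · refine Or.inr fun g x hx => ?_
      have h2 := h.symm_mem hx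
      rw [← h1 g, Submodule.mem_comap, LinearEquiv.coe_coe, e.apply_symm_apply] at h2
      exact h2

end IsTwist

/-- The endomorphism `e x ↦ τ(g, k) e(c(x))` for `x` of degree `k`. -/
def twistEnd {B : GradedAlg.{u, v, x} F G} (e : A.carrier ≃ₗ[F] B.carrier) (τ : Z2sym G Fˣ) (g : G)
    (c : Module.End F A.carrier) : Module.End F B.carrier :=
  (A.glift fun k => (τ.1 g k : F) • (e.toLinearMap ∘ₗ c ∘ₗ (A.deg k).subtype)) ∘ₗ
    e.symm.toLinearMap

/-! ### Transport of the graded centroid to a twist -/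

namespace IsTwist

variable {B : GradedAlg.{u, v, x} F G} {τ : Z2sym G Fˣ} {e : A.carrier ≃ₗ[F] B.carrier}

theorem twistEnd_of_mem (e : A.carrier ≃ₗ[F] B.carrier) (τ : Z2sym G Fˣ) (g : G)
    (c : Module.End F A.carrier) {k : G} {x : A.carrier} (hx : x ∈ A.deg k) :
    twistEnd e τ g c (e x) = (τ.1 g k : F) • e (c x) := by
  rw [twistEnd, LinearMap.comp_apply, LinearEquiv.coe_coe, e.symm_apply_apply]
  exact A.glift_of_mem _ hx

/-- A property of homogeneous elements of `B` may be checked on images of `A`. -/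
theorem forall_mem (h : IsTwist τ A B e) {g : G} {p : B.carrier → Prop}
    (hp : ∀ x ∈ A.deg g, p (e x)) : ∀ y ∈ B.deg g, p y := fun y hy => by
  rw [← e.apply_symm_apply y]
  exact hp _ (h.symm_mem hy)

/-- The factor τ(g, k) treats `c` as an element of degree `g` acting by twisted multiplication. The
cocycle identity gives compatibility with the left factor; for the right factor the symmetry of τ is
needed as well. -/
theorem twistEnd_mem (h : IsTwist τ A B e) {g : G} {c : Module.End F A.carrier}
    (hc : c ∈ A.centroidDeg g) : twistEnd e τ g c ∈ B.centroidDeg g := by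
  refine mem_centroidDeg_of (fun k => h.forall_mem fun x hx => ?_)
    fun k l => h.forall_mem fun x hx => h.forall_mem fun y hy => ?_
  · rw [twistEnd_of_mem e τ g c hx]
    exact Submodule.smul_mem _ _ (h.mem (hc.2 k x hx))
  · rw [h.mul_of_mem k l x hx y hy, map_smul, twistEnd_of_mem e τ g c (A.mul_mem hx hy),
      twistEnd_of_mem e τ g c hx, twistEnd_of_mem e τ g c hy, map_smul, map_smul,
      LinearMap.smul_apply, h.mul_of_mem _ _ _ (hc.2 k x hx) y hy,
      h.mul_of_mem _ _ x hx _ (hc.2 l y hy), ← (hc.1 x y).1, ← (hc.1 x y).2]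
    simp only [smul_smul, ← Units.val_mul]
    constructor
    · rw [Z2sym.cocycle τ g k l, mul_comm (τ.1 k l)]
    · congr 2
      have h1 := Z2sym.cocycle τ g l k
      rw [Z2sym.symm τ k (g * l), h1, mul_comm l k, Z2sym.symm τ l k, mul_comm]

theorem twistEnd_ne_zero (e : A.carrier ≃ₗ[F] B.carrier) (τ : Z2sym G Fˣ) (g : G)
    {c : Module.End F A.carrier} (hc : c ≠ 0) : twistEnd e τ g c ≠ 0 := by
  obtain ⟨k, x, hx, h⟩ := exists_apply_ne_zero hc
  intro h0
  have := twistEnd_of_mem e τ g c hx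
  rw [h0, LinearMap.zero_apply] at this
  exact h (e.map_eq_zero_iff.1 ((smul_eq_zero.1 this.symm).resolve_left (τ.1 g k).ne_zero))

/-- Twisting the algebra multiplies the factor set of its centroid by τ, which is why a suitable
twist can make the centroid untwisted. -/
theorem twistEnd_mul (h : IsTwist τ A B e) (g : G) {k : G} (c : Module.End F A.carrier)
    {d : Module.End F A.carrier} (hd : d ∈ A.centroidDeg k) :
    twistEnd e τ g c * twistEnd e τ k d = (τ.1 g k : F) • twistEnd e τ (g * k) (c * d) := by
  refine linear_ext fun l => h.forall_mem fun x hx => ?_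
  rw [Module.End.mul_apply, LinearMap.smul_apply, twistEnd_of_mem e τ k d hx, map_smul,
    twistEnd_of_mem e τ g c (hd.2 l x hx), twistEnd_of_mem e τ _ _ hx, Module.End.mul_apply]
  simp only [smul_smul, ← Units.val_mul]
  rw [Z2sym.cocycle τ g k l, mul_comm]

theorem centroidDeg_eq_bot (h : IsTwist τ A B e) {g : G} (hB : B.centroidDeg g = ⊥) :
    A.centroidDeg g = ⊥ := by
  by_contra hne
  obtain ⟨c, hc, hc0⟩ := (Submodule.ne_bot_iff _).1 hne
  have := h.twistEnd_mem hc
  rw [hB] at this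
  exact twistEnd_ne_zero e τ g hc0 this

theorem isGradedCentralSimple (h : IsTwist τ A B e) (hA : A.IsGradedCentralSimple) :
    B.IsGradedCentralSimple := by
  refine ⟨h.isGradedSimple hA.1, le_antisymm (fun c hc => ?_) ?_⟩
  · have hc' := h.symm.twistEnd_mem hc
    rw [hA.2] at hc'
    obtain ⟨r, hr⟩ := Submodule.mem_span_singleton.1 hc'
    -- Transport in degree 1 introduces τ(1, k)⁻¹ = τ(1, 1)⁻¹, the same scalar in every degree `k`.
    refine Submodule.mem_span_singleton.2 ⟨(τ.1 1 1 : F) * r, linear_ext fun k x hx => ?_⟩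
    have h1 := twistEnd_of_mem e.symm τ⁻¹ 1 c hx
    rw [← hr, Z2sym.one_left τ⁻¹ k] at h1
    have h2 := congrArg (fun y => (τ.1 1 1 : F) • e y) h1
    simp only [LinearMap.smul_apply, Module.End.one_apply, map_smul, e.apply_symm_apply,
      smul_smul] at h2
    have h3 : (τ.1 1 1 : F) * ((τ⁻¹ : Z2sym G Fˣ).1 1 1 : F) = 1 := (τ.1 1 1).mul_inv
    rw [h3, one_smul] at h2
    exact h2
  · rw [Submodule.span_singleton_le_iff_mem]
    exact one_mem_centroidDeg

end IsTwist

end TwistLemmas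

end GradedAlg

namespace GradedAlg

variable {F : Type u} [Field F] {G : Type v} [CommGroup G]

/-! ## From graded simplicity to simplicity -/

section Simplicity

variable {A : GradedAlg.{u, v, w} F G}

theorem IsSimple.isGradedSimple (hA : A.IsSimple) : A.IsGradedSimple :=
  ⟨hA.1, hA.2.1, fun I hI => hA.2.2 I hI.1⟩

/-- A graded-simple algebra whose centroid has no nonzero homogeneous elements of degree `≠ 1` is
simple. -/
theorem IsGradedSimple.isSimple (hA : A.IsGradedSimple)
    (hC : ∀ g, g ≠ 1 → A.centroidDeg g = ⊥) : A.IsSimple := by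
  classical
  refine ⟨hA.1, hA.2.1, fun I hI => ?_⟩
  by_contra! hne
  obtain ⟨hbot, htop⟩ := hne
  have hhom : ∀ g, ∀ a ∈ A.deg g, a ∈ I → a = 0 := by
    intro g a ha haI
    rcases hA.family (isIdealFamily_inf hI) with h | h
    · have : a ∈ I ⊓ A.deg g := ⟨haI, ha⟩
      rwa [h g] at this
    · exact absurd (eq_top_of_deg_le fun g => (h g).symm.le.trans inf_le_left) htop
  let supp : A.carrier → Finset G := fun a => (A.finite_support a).toFinset
  have hsupp : ∀ a g, g ∈ supp a ↔ A.proj g a ≠ 0 := fun a g => by simp [supp]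
  have hex : ∃ n, ∃ a ∈ I, a ≠ 0 ∧ (supp a).card = n := by
    obtain ⟨a, ha, ha0⟩ := (Submodule.ne_bot_iff _).1 hbot
    exact ⟨_, a, ha, ha0, rfl⟩
  -- Here `a` has minimal support among the nonzero elements of `I`. As `I` has no nonzero
  -- homogeneous element, the support contains two degrees `p ≠ p'`.
  obtain ⟨a, haI, ha0, hacard⟩ := Nat.find_spec hex
  have hmin : ∀ b ∈ I, (supp b).card < (supp a).card → b = 0 := by
    intro b hb hlt
    by_contra hb0
    exact Nat.find_min hex (hacard ▸ hlt) ⟨b, hb, hb0, rfl⟩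
  obtain ⟨p, hp⟩ : ∃ p, A.proj p a ≠ 0 := by
    by_contra! h
    exact ha0 (eq_zero_of_proj h)
  obtain ⟨p', hp', hpp'⟩ : ∃ p', A.proj p' a ≠ 0 ∧ p' ≠ p := by
    by_contra! h
    have h1 : a - A.proj p a = 0 := eq_zero_of_proj fun k => by
      by_cases hk : k = p
      · rw [hk, map_sub, A.proj_of_mem (A.proj_mem p a), sub_self]
      · rw [map_sub, A.proj_of_mem_ne (A.proj_mem p a) (Ne.symm hk), sub_zero]
        by_contra h2
        exact hk (h k h2)
    rw [sub_eq_zero] at h1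
    exact ha0 (hhom p a (h1 ▸ A.proj_mem p a) haI)
  -- `Z t` consists of the elements of `I` supported in `t · supp(a)`. By minimality such an element
  -- is determined by its component of degree `t p`.
  let Z : G → Submodule F A.carrier := fun t =>
    I ⊓ ⨅ r, ⨅ (_ : A.proj r a = 0), LinearMap.ker (A.proj (t * r))
  have hZ : ∀ t z, z ∈ Z t ↔ z ∈ I ∧ ∀ r, A.proj r a = 0 → A.proj (t * r) z = 0 := by
    intro t z
    simp [Z, Submodule.mem_iInf]
  have hZmul : ∀ t k, ∀ z ∈ Z t, ∀ b ∈ A.deg k, A.mul z b ∈ Z (t * k) ∧ A.mul b z ∈ Z (t * k) := by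
    intro t k z hz b hb
    rw [hZ] at hz
    rw [hZ, hZ]
    refine ⟨⟨(hI b z hz.1).2, fun r hr => ?_⟩, (hI b z hz.1).1, fun r hr => ?_⟩
    · rw [mul_right_comm, A.proj_mul_right hb, hz.2 r hr, map_zero, LinearMap.zero_apply]
    · rw [mul_right_comm, A.proj_mul_left hb, hz.2 r hr, map_zero]
  have hZinj : ∀ t, ∀ z ∈ Z t, A.proj (t * p) z = 0 → z = 0 := by
    intro t z hz h0
    rw [hZ] at hz
    refine hmin z hz.1 ?_
    have hsub : (supp z).image (fun g => t⁻¹ * g) ⊆ (supp a).erase p := by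
      intro g hg
      obtain ⟨k, hk, rfl⟩ := Finset.mem_image.1 hg
      rw [hsupp] at hk
      rw [Finset.mem_erase, hsupp]
      refine ⟨?_, fun h => hk ?_⟩
      · rintro rfl
        rw [mul_inv_cancel_left] at h0
        exact hk h0
      · simpa using hz.2 _ h
    calc (supp z).card = ((supp z).image fun g => t⁻¹ * g).card :=
          (Finset.card_image_of_injective _ (mul_right_injective _)).symm
      _ ≤ ((supp a).erase p).card := Finset.card_le_card hsub
      _ < (supp a).card := Finset.card_erase_lt_of_mem ((hsupp a p).2 hp)
  have haZ : a ∈ Z (p * p⁻¹) := by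
    rw [hZ]; exact ⟨haI, fun r hr => by rw [mul_inv_cancel, one_mul, hr]⟩
  -- The components at `q` of `Z (q p⁻¹)` form an ideal family containing `a_p ≠ 0`. By graded
  -- simplicity every element of degree `q` is therefore the component of a unique `z`.
  have hS : A.IsIdealFamily fun q => (Z (q * p⁻¹)).map (A.proj q) := by
    refine ⟨fun q => ?_, fun q k x hx b hb => ?_⟩
    · rintro _ ⟨z, -, rfl⟩; exact A.proj_mem q z
    · obtain ⟨z, hz, rfl⟩ := hx
      have h1 := hZmul _ k z hz b hb
      rw [mul_right_comm] at h1
      exact ⟨⟨_, h1.1, A.proj_mul_right hb q z⟩, ⟨_, h1.2, A.proj_mul_left hb q z⟩⟩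
  have hStop : ∀ q, (Z (q * p⁻¹)).map (A.proj q) = A.deg q := by
    rcases hA.family hS with h | h
    · have h1 : A.proj p a ∈ (Z (p * p⁻¹)).map (A.proj p) := ⟨a, haZ, rfl⟩
      rw [h p] at h1
      exact absurd h1 hp
    · exact h
  let E : ∀ q, Z (q * p⁻¹) ≃ₗ[F] A.deg q := fun q =>
    LinearEquiv.ofBijective
      ((A.proj q ∘ₗ (Z (q * p⁻¹)).subtype).codRestrict (A.deg q) fun z => A.proj_mem q _) <| by
      constructor
      · rw [injective_iff_map_eq_zero]
        intro z hz
        refine Subtype.ext (hZinj _ z.1 z.2 ?_)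
        rw [inv_mul_cancel_right]
        exact congrArg Subtype.val hz
      · intro y
        obtain ⟨z, hz, h⟩ := (hStop q).symm.le y.2
        exact ⟨⟨z, hz⟩, Subtype.ext h⟩
  -- Reading off the component at `p'` instead of `p` gives a centroid element of degree `p⁻¹p' ≠ 1`
  -- sending `a_p` to `a_{p'} ≠ 0`.
  let d : Module.End F A.carrier := A.glift fun q =>
    A.proj (p⁻¹ * p' * q) ∘ₗ (Z (q * p⁻¹)).subtype ∘ₗ (E q).symm.toLinearMap
  have hd : ∀ q, ∀ z ∈ Z (q * p⁻¹), d (A.proj q z) = A.proj (p⁻¹ * p' * q) z := by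
    intro q z hz
    have h1 : (⟨A.proj q z, A.proj_mem q z⟩ : A.deg q) = E q ⟨z, hz⟩ := rfl
    rw [A.glift_of_mem _ (A.proj_mem q z), h1]
    simp
  have hlift : ∀ q, ∀ x ∈ A.deg q, ∃ z ∈ Z (q * p⁻¹), A.proj q z = x := by
    intro q x hx
    rw [← hStop q] at hx
    exact hx
  have hdC : d ∈ A.centroidDeg (p⁻¹ * p') := by
    refine mem_centroidDeg_of (fun k x hx => ?_) fun k l x hx y hy => ⟨?_, ?_⟩
    · obtain ⟨z, hz, rfl⟩ := hlift k x hx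
      rw [hd k z hz]
      exact A.proj_mem _ _
    · obtain ⟨z, hz, rfl⟩ := hlift k x hx
      have h1 := (hZmul _ l z hz y hy).1
      rw [mul_right_comm] at h1
      rw [← A.proj_mul_right hy, hd _ _ h1, hd k z hz, ← mul_assoc, A.proj_mul_right hy]
    · obtain ⟨z, hz, rfl⟩ := hlift l y hy
      have h1 := (hZmul _ k z hz x hx).2
      rw [mul_right_comm] at h1
      rw [← A.proj_mul_left hx, hd _ _ h1, hd l z hz, ← mul_assoc, A.proj_mul_left hx]
  rw [hC _ (by rwa [Ne, inv_mul_eq_one, eq_comm])] at hdC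
  have hd0 : d = 0 := hdC
  apply hp'
  have := hd p a haZ
  rw [hd0, LinearMap.zero_apply, mul_comm _ p, mul_inv_cancel_left] at this
  exact this.symm

/-- The homogeneous component of degree `g` of an element of the centroid. -/
theorem exists_centroid_component {c : Module.End F A.carrier} (hc : c ∈ A.centroid) (g : G) :
    ∃ d ∈ A.centroidDeg g, ∀ k, ∀ x ∈ A.deg k, d x = A.proj (g * k) (c x) := by
  have hd : ∀ k, ∀ x ∈ A.deg k, A.glift (fun k => A.proj (g * k) ∘ₗ c ∘ₗ (A.deg k).subtype) x =
      A.proj (g * k) (c x) := fun k x hx => A.glift_of_mem _ hx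
  refine ⟨_, mem_centroidDeg_of (fun k x hx => ?_) fun k l x hx y hy => ⟨?_, ?_⟩, hd⟩
  · rw [hd k x hx]; exact A.proj_mem _ _
  · rw [hd _ _ (A.mul_mem hx hy), hd k x hx, (hc x y).1, ← mul_assoc, A.proj_mul_right hy]
  · rw [hd _ _ (A.mul_mem hx hy), hd l y hy, (hc x y).2, mul_comm k, ← mul_assoc,
      A.proj_mul_left hx]

/-- Homogeneous components of a centroid element lie in the centroid. Those of degree ≠ 1 vanish, so
the element preserves degrees and is a scalar. -/
theorem IsGradedCentralSimple.isCentralSimple (hA : A.IsGradedCentralSimple)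
    (hC : ∀ g, g ≠ 1 → A.centroidDeg g = ⊥) : A.IsCentralSimple := by
  refine ⟨hA.1.isSimple hC, le_antisymm (fun c hc => ?_) ?_⟩
  · rw [← hA.2]
    refine ⟨hc, fun k x hx => ?_⟩
    have h1 : c x - A.proj k (c x) = 0 := eq_zero_of_proj fun l => by
      by_cases hl : l = k
      · rw [hl, map_sub, A.proj_of_mem (A.proj_mem k _), sub_self]
      · obtain ⟨d, hd, hdx⟩ := exists_centroid_component hc (l * k⁻¹)
        rw [hC _ (by rwa [Ne, mul_inv_eq_one])] at hd
        have h2 := hdx k x hx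
        rw [show d = 0 from hd, LinearMap.zero_apply, inv_mul_cancel_right] at h2
        rw [map_sub, A.proj_of_mem_ne (A.proj_mem k _) (Ne.symm hl), ← h2, sub_zero]
    rw [sub_eq_zero] at h1
    rw [h1, one_mul]
    exact A.proj_mem _ _
  · rw [Submodule.span_singleton_le_iff_mem]
    exact one_mem A.centroid

end Simplicity

/-! ## Coverings by loop algebras -/

section Cover

variable {H : Subgroup G}

/-- `P` exhibits `B` as the loop algebra of `A`: it is a homomorphism which restricts to
isomorphisms `B_g → A_{π(g)}`. -/
structure IsCover (B : GradedAlg.{u, v, w} F G) (A : GradedAlg.{u, v, x} F (G ⧸ H))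
    (P : B.carrier →ₗ[F] A.carrier) : Prop where
  map_mul : ∀ x y, P (B.mul x y) = A.mul (P x) (P y)
  mem : ∀ g : G, ∀ x ∈ B.deg g, P x ∈ A.deg (g : G ⧸ H)
  eq_zero : ∀ g : G, ∀ x ∈ B.deg g, P x = 0 → x = 0
  exists_lift : ∀ g : G, ∀ a ∈ A.deg (g : G ⧸ H), ∃ x ∈ B.deg g, P x = a

namespace IsCover

variable {B : GradedAlg.{u, v, w} F G} {A : GradedAlg.{u, v, x} F (G ⧸ H)}
  {P : B.carrier →ₗ[F] A.carrier}

theorem eq_of_mem (hP : IsCover B A P) {g : G} {x y : B.carrier} (hx : x ∈ B.deg g)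
    (hy : y ∈ B.deg g) (h : P x = P y) : x = y :=
  sub_eq_zero.1 (hP.eq_zero g _ (sub_mem hx hy) (by rw [map_sub, h, sub_self]))

theorem surjective (hP : IsCover B A P) : Function.Surjective P := by
  rw [← LinearMap.range_eq_top]
  refine eq_top_of_deg_le fun q => ?_
  obtain ⟨g, rfl⟩ := QuotientGroup.mk_surjective q
  intro a ha
  obtain ⟨x, -, h⟩ := hP.exists_lift g a ha
  exact ⟨x, h⟩

/-- The isomorphism `B_g ≃ A_{π(g)}`. -/
def degEquiv (hP : IsCover B A P) (g : G) : B.deg g ≃ₗ[F] A.deg (g : G ⧸ H) :=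
  LinearEquiv.ofBijective (P.restrict (hP.mem g)) <| by
    constructor
    · rw [injective_iff_map_eq_zero]
      exact fun x hx => Subtype.ext (hP.eq_zero g x.1 x.2 (congrArg Subtype.val hx))
    · intro a
      obtain ⟨x, hx, h⟩ := hP.exists_lift g a.1 a.2
      exact ⟨⟨x, hx⟩, Subtype.ext h⟩

theorem apply_degEquiv_symm (hP : IsCover B A P) (g : G) (a : A.deg (g : G ⧸ H)) :
    P ((hP.degEquiv g).symm a : B.deg g) = a :=
  congrArg Subtype.val ((hP.degEquiv g).apply_symm_apply a)

/-- Linear maps to `A` which are homogeneous of degree `π(g)` lift to `B`. -/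
theorem exists_linear_lift (hP : IsCover B A P) {C : GradedAlg.{u, v, y} F G}
    (f : C.carrier →ₗ[F] A.carrier) (g : G)
    (hf : ∀ k, ∀ x ∈ C.deg k, f x ∈ A.deg ((g * k : G) : G ⧸ H)) :
    ∃ f' : C.carrier →ₗ[F] B.carrier, (∀ x, P (f' x) = f x) ∧
      ∀ k, ∀ x ∈ C.deg k, f' x ∈ B.deg (g * k) := by
  let f' : C.carrier →ₗ[F] B.carrier := C.glift fun k =>
    (B.deg (g * k)).subtype ∘ₗ (hP.degEquiv (g * k)).symm.toLinearMap ∘ₗ f.restrict (hf k)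
  have hf' : ∀ k x (hx : x ∈ C.deg k),
      f' x = ((hP.degEquiv (g * k)).symm (f.restrict (hf k) ⟨x, hx⟩) : B.deg (g * k)) :=
    fun k x hx => C.glift_of_mem _ hx
  refine ⟨f', fun x => ?_, fun k x hx => ?_⟩
  · have : P ∘ₗ f' = f := linear_ext fun k x hx => by
      rw [LinearMap.comp_apply, hf' k x hx, hP.apply_degEquiv_symm]
      rfl
    exact LinearMap.congr_fun this x
  · rw [hf' k x hx]
    exact Subtype.mem _

/-- Two coverings of the same algebra are isomorphic. -/
theorem gradedIso {B₁ B₂ : GradedAlg.{u, v, w} F G} {P₁ : B₁.carrier →ₗ[F] A.carrier}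
    {P₂ : B₂.carrier →ₗ[F] A.carrier} (h₁ : IsCover B₁ A P₁) (h₂ : IsCover B₂ A P₂) :
    B₁.GradedIso B₂ := by
  obtain ⟨f, hf, hdeg⟩ := h₂.exists_linear_lift P₁ 1
    (fun k x hx => by rw [one_mul]; exact h₁.mem k x hx)
  simp only [one_mul] at hdeg
  refine gradedIso_of_components B₁ f (fun k l x hx y hy => ?_) hdeg (fun k x hx h0 => ?_)
    fun k y hy => ?_
  · refine h₂.eq_of_mem (hdeg _ _ (B₁.mul_mem hx hy)) (B₂.mul_mem (hdeg k x hx) (hdeg l y hy)) ?_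
    rw [hf, h₁.map_mul, h₂.map_mul, hf, hf]
  · refine h₁.eq_zero k x hx ?_
    rw [← hf, h0, map_zero]
  · obtain ⟨x, hx, h⟩ := h₁.exists_lift k _ (h₂.mem k y hy)
    exact ⟨x, hx, h₂.eq_of_mem (hdeg k x hx) hy (by rw [hf, h])⟩

/-- Twists are compatible with coverings. -/
theorem twist (hP : IsCover B A P) {μ : Z2sym (G ⧸ H) Fˣ} {B' : GradedAlg.{u, v, w} F G}
    {A' : GradedAlg.{u, v, x} F (G ⧸ H)} {e : B.carrier ≃ₗ[F] B'.carrier}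
    {f : A.carrier ≃ₗ[F] A'.carrier}
    (he : IsTwist (Z2sym.comap Fˣ (QuotientGroup.mk' H) μ) B B' e) (hf : IsTwist μ A A' f) :
    IsCover B' A' (f.toLinearMap ∘ₗ P ∘ₗ e.symm.toLinearMap) := by
  refine ⟨fun x y => ?_, fun g => he.forall_mem fun x hx => ?_,
    fun g => he.forall_mem fun x hx h0 => ?_, fun g a ha => ?_⟩
  · let Q := f.toLinearMap ∘ₗ P ∘ₗ e.symm.toLinearMap
    have : B'.mul.compr₂ Q = A'.mul.compl₁₂ Q Q := by
      refine B'.bilin_ext fun k l => he.forall_mem fun x hx => he.forall_mem fun y hy => ?_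
      simp only [LinearMap.compr₂_apply, LinearMap.compl₁₂_apply, Q, LinearMap.comp_apply,
        LinearEquiv.coe_coe, e.symm_apply_apply]
      rw [he.mul_of_mem k l x hx y hy, map_smul, map_smul, map_smul, e.symm_apply_apply,
        hP.map_mul, hf.mul_of_mem _ _ _ (hP.mem k x hx) _ (hP.mem l y hy)]
      rfl
    exact LinearMap.congr_fun₂ this x y
  · simp only [LinearMap.comp_apply, LinearEquiv.coe_coe, e.symm_apply_apply]
    exact hf.mem (hP.mem g x hx)
  · simp only [LinearMap.comp_apply, LinearEquiv.coe_coe, e.symm_apply_apply] at h0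
    rw [hP.eq_zero g x hx (f.map_eq_zero_iff.1 h0), map_zero]
  · obtain ⟨x, hx, h⟩ := hP.exists_lift g _ (hf.symm_mem ha)
    refine ⟨e x, he.mem hx, ?_⟩
    simp only [LinearMap.comp_apply, LinearEquiv.coe_coe, e.symm_apply_apply]
    rw [h, f.apply_symm_apply]

/-- Homogeneous elements of the centroid of `A` lift to `B`. -/
theorem exists_centroid_lift (hP : IsCover B A P) {g : G} {d : Module.End F A.carrier}
    (hd : d ∈ A.centroidDeg (g : G ⧸ H)) : ∃ c ∈ B.centroidDeg g, ∀ x, P (c x) = d (P x) := by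
  obtain ⟨c, hc, hdeg⟩ := hP.exists_linear_lift (C := B) (d ∘ₗ P) g
    fun k x hx => hd.2 _ _ (hP.mem k x hx)
  refine ⟨c, mem_centroidDeg_of hdeg fun k l x hx y hy => ⟨?_, ?_⟩, hc⟩
  · refine hP.eq_of_mem (hdeg _ _ (B.mul_mem hx hy)) ?_ ?_
    · rw [← mul_assoc]; exact B.mul_mem (hdeg k x hx) hy
    · rw [hc, LinearMap.comp_apply, hP.map_mul, hP.map_mul, hc, (hd.1 _ _).1]; rfl
  · refine hP.eq_of_mem (hdeg _ _ (B.mul_mem hx hy)) ?_ ?_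
    · rw [mul_left_comm]; exact B.mul_mem hx (hdeg l y hy)
    · rw [hc, LinearMap.comp_apply, hP.map_mul, hP.map_mul, hc, (hd.1 _ _).2]; rfl

/-! ### Deck transformations and descent -/

theorem exists_shift (hP : IsCover B A P) (h : H) :
    ∃ c ∈ B.centroidDeg (h : G), ∀ x, P (c x) = P x :=
  -- The identity of `A` has degree π(h) = 1, so it lifts in degree `h`.
  hP.exists_centroid_lift (g := (h : G)) (d := 1)
    (by rw [(QuotientGroup.eq_one_iff (h : G)).2 h.2]; exact one_mem_centroidDeg)

/-- The deck transformation of degree `h ∈ H`. -/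
def shift (hP : IsCover B A P) (h : H) : Module.End F B.carrier := (hP.exists_shift h).choose

theorem shift_mem (hP : IsCover B A P) (h : H) : hP.shift h ∈ B.centroidDeg (h : G) :=
  (hP.exists_shift h).choose_spec.1

theorem apply_shift (hP : IsCover B A P) (h : H) (x : B.carrier) : P (hP.shift h x) = P x :=
  (hP.exists_shift h).choose_spec.2 x

theorem shift_eq (hP : IsCover B A P) (h : H) {g : G} {x y : B.carrier} (hx : x ∈ B.deg g)
    (hy : y ∈ B.deg (h * g)) (hxy : P y = P x) : hP.shift h x = y :=
  hP.eq_of_mem ((hP.shift_mem h).2 g x hx) hy (by rw [hP.apply_shift, hxy])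

/-- Lifts through `P` in a prescribed degree are unique, so the deck transformations compose without
any cocycle. -/
theorem shift_mul (hP : IsCover B A P) (h k : H) :
    hP.shift h * hP.shift k = hP.shift (h * k) :=
  linear_ext fun g x hx => by
    symm
    refine hP.shift_eq (h * k) hx ?_ ?_
    · rw [Subgroup.coe_mul, mul_assoc]
      exact (hP.shift_mem h).2 _ _ ((hP.shift_mem k).2 _ _ hx)
    · rw [Module.End.mul_apply, hP.apply_shift, hP.apply_shift]

theorem shift_ne_zero (hP : IsCover B A P) (hA : Nontrivial A.carrier) (h : H) :
    hP.shift h ≠ 0 := by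
  obtain ⟨a, ha⟩ := @exists_ne _ hA (0 : A.carrier)
  obtain ⟨x, rfl⟩ := hP.surjective a
  intro h0
  apply ha
  rw [← hP.apply_shift h, h0, LinearMap.zero_apply, map_zero]

/-- Linear maps invariant under deck transformations descend to `A`. -/
theorem exists_descent (hP : IsCover B A P) {V : Type*} [AddCommGroup V] [Module F V]
    (f : B.carrier →ₗ[F] V) (hf : ∀ h x, f (hP.shift h x) = f x) :
    ∃ f' : A.carrier →ₗ[F] V, ∀ x, f' (P x) = f x := by
  have hout : ∀ q : G ⧸ H, ((q.out : G) : G ⧸ H) = q := fun q => q.out_eq'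
  -- The value is computed on the lift at the chosen coset representative; a lift in degree `g`
  -- differs from it by the deck transformation of degree `q.out * g⁻¹`.
  let f' : A.carrier →ₗ[F] V := A.glift fun q =>
    f ∘ₗ (B.deg q.out).subtype ∘ₗ (hP.degEquiv q.out).symm.toLinearMap ∘ₗ
      Submodule.inclusion (congrArg A.deg (hout q)).symm.le
  refine ⟨f', fun x => ?_⟩
  have : f' ∘ₗ P = f := linear_ext fun g x hx => by
    have hm := hP.mem g x hx
    have hm' : P x ∈ A.deg (((g : G ⧸ H).out : G) : G ⧸ H) := by rwa [hout]
    have e : f' (P x) = f ((hP.degEquiv (g : G ⧸ H).out).symm ⟨P x, hm'⟩ : B.deg _) :=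
      A.glift_of_mem _ hm
    let h : H := ⟨(g : G ⧸ H).out * g⁻¹, by
      rw [mul_comm]; exact QuotientGroup.eq.1 (hout g).symm⟩
    rw [LinearMap.comp_apply, e, ← hf h x]
    congr 1
    symm
    refine hP.shift_eq h hx ?_ (hP.apply_degEquiv_symm _ _)
    change _ ∈ B.deg ((g : G ⧸ H).out * g⁻¹ * g)
    rw [inv_mul_cancel_right]
    exact Subtype.mem _
  exact LinearMap.congr_fun this x

/-- Deck transformations lie in the centroid, which is commutative, so `P ∘ c` is invariant under
them. -/
theorem exists_centroid_descent (hP : IsCover B A P) (hB : B.square = ⊤) {g : G}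
    {c : Module.End F B.carrier} (hc : c ∈ B.centroidDeg g) :
    ∃ d ∈ A.centroidDeg (g : G ⧸ H), ∀ x, d (P x) = P (c x) := by
  obtain ⟨d, hd⟩ := hP.exists_descent (P ∘ₗ c) fun h x => by
    have := LinearMap.congr_fun (centroid_mul_comm hB hc.1 (hP.shift_mem h).1) x
    rw [Module.End.mul_apply, Module.End.mul_apply] at this
    rw [LinearMap.comp_apply, this, hP.apply_shift, LinearMap.comp_apply]
  simp only [LinearMap.comp_apply] at hd
  refine ⟨d, ⟨fun a b => ?_, fun q a ha => ?_⟩, hd⟩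
  · obtain ⟨x, rfl⟩ := hP.surjective a
    obtain ⟨y, rfl⟩ := hP.surjective b
    rw [← hP.map_mul, hd, hd, hd, ← hP.map_mul, ← hP.map_mul, ← (hc.1 x y).1, ← (hc.1 x y).2]
    exact ⟨rfl, rfl⟩
  · obtain ⟨k, rfl⟩ := QuotientGroup.mk_surjective q
    obtain ⟨x, hx, rfl⟩ := hP.exists_lift k a ha
    rw [hd]
    exact hP.mem _ _ (hc.2 k x hx)

/-! ### Transfer of simplicity and centrality along a covering -/

theorem square_eq_top (hP : IsCover B A P) (hA : A.square = ⊤) : B.square = ⊤ := by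
  -- Elements of `W` have their component at π(g) lifted to `B² ∩ B_g` for every `g`. For a product
  -- `ab`, lifting `a` to a fixed degree `k` and `b` to degree `k⁻¹g` reaches each `g` in the coset.
  let W : Submodule F A.carrier :=
    ⨅ g : G, ((B.square ⊓ B.deg g).map P).comap (A.proj (g : G ⧸ H))
  have hW : A.square ≤ W := Submodule.map₂_le.2 fun a _ b _ => by
    refine A.bilin_mem_of_homogeneous (fun q r a ha b hb => ?_) a b
    refine (Submodule.mem_iInf _).2 fun g => ?_
    rw [Submodule.mem_comap]
    by_cases hg : q * r = (g : G ⧸ H)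
    · obtain ⟨k, rfl⟩ := QuotientGroup.mk_surjective q
      have hr : r = ((k⁻¹ * g : G) : G ⧸ H) := by
        rw [QuotientGroup.mk_mul, ← hg, QuotientGroup.mk_inv, inv_mul_cancel_left]
      rw [hr] at hb
      obtain ⟨x, hx, rfl⟩ := hP.exists_lift k a ha
      obtain ⟨y, hy, rfl⟩ := hP.exists_lift _ b hb
      refine ⟨B.mul x y, ⟨mul_mem_square x y, ?_⟩, ?_⟩
      · have := B.mul_mem hx hy
        rwa [mul_inv_cancel_left] at this
      · rw [hP.map_mul, ← hg, hr, A.proj_of_mem (A.mul_mem ha hb)]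
    · rw [A.proj_of_mem_ne (A.mul_mem ha hb) hg]
      exact zero_mem _
  refine eq_top_of_deg_le fun g x hx => ?_
  have h1 : P x ∈ W := hW (hA ▸ trivial)
  have h2 := (Submodule.mem_iInf _).1 h1 g
  rw [Submodule.mem_comap, A.proj_of_mem (hP.mem g x hx)] at h2
  obtain ⟨y, hy, h⟩ := h2
  rw [← hP.eq_of_mem hy.2 hx h]
  exact hy.1

/-- The images `P(S_g)` may vary with `g` inside a coset, so the ideal of `A` is built from elements
lifting to `S_g` for all `g` over `q` at once. If it is everything, so is `S`. If it is zero, each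
`P(S_g)` annihilates `A` and hence vanishes. -/
theorem isGradedSimple (hP : IsCover B A P) (hA : A.IsGradedSimple) : B.IsGradedSimple := by
  refine isGradedSimple_of_family ?_ (hP.square_eq_top hA.2.1) fun S hS => ?_
  · have := hA.1
    exact hP.surjective.nontrivial
  · let T : G ⧸ H → Submodule F A.carrier := fun q =>
      A.deg q ⊓ ⨅ g : G, ⨅ (_ : (g : G ⧸ H) = q), (S g).map P
    have hT : ∀ q a, a ∈ T q ↔ a ∈ A.deg q ∧ ∀ g : G, (g : G ⧸ H) = q → ∃ x ∈ S g, P x = a := by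
      intro q a
      simp [T, Submodule.mem_iInf]
    have hTf : A.IsIdealFamily T := by
      refine ⟨fun q => inf_le_left, fun q r a ha b hb => ?_⟩
      rw [hT] at ha
      obtain ⟨k, rfl⟩ := QuotientGroup.mk_surjective r
      obtain ⟨y, hy, rfl⟩ := hP.exists_lift k b hb
      have key : ∀ g : G, (g : G ⧸ H) = q * k → ∃ x ∈ S (g * k⁻¹), P x = a := fun g hg =>
        ha.2 _ (by rw [QuotientGroup.mk_mul, hg, QuotientGroup.mk_inv, mul_inv_cancel_right])
      rw [hT, hT]
      refine ⟨⟨A.mul_mem ha.1 hb, fun g hg => ?_⟩,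
        by rw [mul_comm]; exact A.mul_mem hb ha.1, fun g hg => ?_⟩
      · obtain ⟨x, hx, rfl⟩ := key g hg
        have := (hS.2 _ _ x hx y hy).1
        rw [inv_mul_cancel_right] at this
        exact ⟨_, this, hP.map_mul _ _⟩
      · obtain ⟨x, hx, rfl⟩ := key g hg
        have := (hS.2 _ _ x hx y hy).2
        rw [inv_mul_cancel_right] at this
        exact ⟨_, this, hP.map_mul _ _⟩
    rcases hA.family hTf with h | h
    · refine Or.inl fun g => (Submodule.eq_bot_iff _).2 fun x hx => ?_
      refine hP.eq_zero g x (hS.1 g hx) (hA.eq_zero_of_annihilates (hP.mem g x (hS.1 g hx)) ?_)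
      intro r b hb
      -- Since `b` lifts to every degree over `r`, the products with `x` lift to `S` in every degree
      -- of the coset.
      have key : A.mul (P x) b ∈ T (g * r) ∧ A.mul b (P x) ∈ T (g * r) := by
        have hPx := hP.mem g x (hS.1 g hx)
        rw [hT, hT]
        have hl : ∀ k : G, (k : G ⧸ H) = g * r → ∃ y ∈ B.deg (g⁻¹ * k), P y = b := fun k hk =>
          hP.exists_lift _ _ (by
            rwa [QuotientGroup.mk_mul, hk, QuotientGroup.mk_inv, inv_mul_cancel_left])
        refine ⟨⟨A.mul_mem hPx hb, fun k hk => ?_⟩,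
          by rw [mul_comm]; exact A.mul_mem hb hPx, fun k hk => ?_⟩
        · obtain ⟨y, hy, rfl⟩ := hl k hk
          have := (hS.2 _ _ x hx y hy).1
          rw [mul_inv_cancel_left] at this
          exact ⟨_, this, hP.map_mul _ _⟩
        · obtain ⟨y, hy, rfl⟩ := hl k hk
          have := (hS.2 _ _ x hx y hy).2
          rw [mul_inv_cancel_left] at this
          exact ⟨_, this, hP.map_mul _ _⟩
      rw [h] at key
      exact key
    · refine Or.inr fun g x hx => ?_
      have h1 := hP.mem g x hx
      rw [← h, hT] at h1
      obtain ⟨y, hy, hxy⟩ := h1.2 g rfl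
      rwa [← hP.eq_of_mem (hS.1 g hy) hx hxy]

/-- The loop algebra of a central simple algebra is graded-central-simple. -/
theorem isGradedCentralSimple (hP : IsCover B A P) (hA : A.IsCentralSimple) :
    B.IsGradedCentralSimple := by
  have hB := hP.isGradedSimple hA.1.isGradedSimple
  refine ⟨hB, le_antisymm (fun c hc => ?_) ?_⟩
  · obtain ⟨d, hd, hdc⟩ := hP.exists_centroid_descent hB.2.1 hc
    have h1 : d ∈ Subalgebra.toSubmodule A.centroid := hd.1
    rw [hA.2] at h1
    obtain ⟨r, rfl⟩ := Submodule.mem_span_singleton.1 h1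
    refine Submodule.mem_span_singleton.2 ⟨r, linear_ext fun g x hx => ?_⟩
    refine hP.eq_of_mem (Submodule.smul_mem _ r hx) (by simpa using hc.2 g x hx) ?_
    rw [← hdc]
    exact map_smul P r x
  · rw [Submodule.span_singleton_le_iff_mem]
    exact one_mem_centroidDeg

/-- Such a `c` descends to a scalar of `A` that also shifts degrees by π(g) ≠ 1, hence to zero. -/
theorem centroidDeg_eq_bot (hP : IsCover B A P) (hA : A.IsCentralSimple) {g : G} (hg : g ∉ H) :
    B.centroidDeg g = ⊥ := by
  have hB := hP.isGradedSimple hA.1.isGradedSimple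
  refine (Submodule.eq_bot_iff _).2 fun c hc => ?_
  obtain ⟨d, hd, hdc⟩ := hP.exists_centroid_descent hB.2.1 hc
  have h1 : d ∈ Subalgebra.toSubmodule A.centroid := hd.1
  rw [hA.2] at h1
  obtain ⟨r, rfl⟩ := Submodule.mem_span_singleton.1 h1
  refine linear_ext fun k x hx => hP.eq_zero _ _ (hc.2 k x hx) ?_
  have hm := hP.mem k x hx
  rw [← hdc]
  refine eq_zero_of_mem_of_mem (hd.2 _ _ hm) (Submodule.smul_mem _ r hm) ?_
  rw [Ne, mul_eq_right, QuotientGroup.eq_one_iff]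
  exact hg

theorem centroidDeg_ne_bot (hP : IsCover B A P) (hA : Nontrivial A.carrier) {g : G} (hg : g ∈ H) :
    B.centroidDeg g ≠ ⊥ :=
  (Submodule.ne_bot_iff _).2 ⟨_, hP.shift_mem ⟨g, hg⟩, hP.shift_ne_zero hA ⟨g, hg⟩⟩

/-- An algebra covered by a graded-central-simple algebra whose centroid is supported in `H` is
central simple. -/
theorem isCentralSimple (hP : IsCover B A P) (hB : B.IsGradedCentralSimple)
    (hC : ∀ g ∉ H, B.centroidDeg g = ⊥) : A.IsCentralSimple := by
  have hA : A.IsGradedSimple := by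
    refine isGradedSimple_of_family ?_ ?_ fun T hT => ?_
    · obtain ⟨k, x, hx, h⟩ := exists_apply_ne_zero hB.1.one_ne_zero
      exact ⟨P x, 0, fun h0 => h (hP.eq_zero k x hx h0)⟩
    · have h1 : B.square ≤ A.square.comap P := Submodule.map₂_le.2 fun x _ y _ => by
        rw [Submodule.mem_comap, hP.map_mul]
        exact mul_mem_square _ _
      rw [hB.1.2.1] at h1
      refine eq_top_iff.2 fun a _ => ?_
      obtain ⟨x, rfl⟩ := hP.surjective a
      exact h1 trivial
    · have hS : B.IsIdealFamily fun g => B.deg g ⊓ (T (g : G ⧸ H)).comap P := by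
        refine ⟨fun g => inf_le_left, fun g k x hx y hy => ?_⟩
        have h1 := hT.2 _ _ _ hx.2 _ (hP.mem k y hy)
        rw [← hP.map_mul, ← hP.map_mul] at h1
        exact ⟨⟨B.mul_mem hx.1 hy, h1.1⟩, by rw [mul_comm]; exact B.mul_mem hy hx.1, h1.2⟩
      rcases hB.1.family hS with h | h
      · refine Or.inl fun q => (Submodule.eq_bot_iff _).2 fun a ha => ?_
        obtain ⟨g, rfl⟩ := QuotientGroup.mk_surjective q
        obtain ⟨x, hx, rfl⟩ := hP.exists_lift g a (hT.1 _ ha)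
        have h1 : x ∈ B.deg g ⊓ (T (g : G ⧸ H)).comap P := ⟨hx, ha⟩
        rw [h g] at h1
        rw [show x = 0 from h1, map_zero]
      · refine Or.inr fun q a ha => ?_
        obtain ⟨g, rfl⟩ := QuotientGroup.mk_surjective q
        obtain ⟨x, hx, rfl⟩ := hP.exists_lift g a ha
        rw [← h g] at hx
        exact hx.2
  -- Centroid elements of `A` lift to scalars in degree 1, and to `C(B)_g = 0` in degree π(g) ≠ 1;
  -- the latter upgrades graded simplicity to simplicity.
  refine IsGradedCentralSimple.isCentralSimple ⟨hA, le_antisymm (fun d hd => ?_) ?_⟩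
    fun q hq => (Submodule.eq_bot_iff _).2 fun d hd => ?_
  · obtain ⟨c, hc, hcd⟩ := hP.exists_centroid_lift (g := 1) (d := d) hd
    rw [hB.2] at hc
    obtain ⟨r, rfl⟩ := Submodule.mem_span_singleton.1 hc
    refine Submodule.mem_span_singleton.2 ⟨r, LinearMap.ext fun a => ?_⟩
    obtain ⟨x, rfl⟩ := hP.surjective a
    rw [← hcd]
    exact (map_smul P r x).symm
  · rw [Submodule.span_singleton_le_iff_mem]
    exact one_mem_centroidDeg
  · obtain ⟨g, rfl⟩ := QuotientGroup.mk_surjective q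
    obtain ⟨c, hc, hcd⟩ := hP.exists_centroid_lift hd
    rw [hC g (by rwa [Ne, QuotientGroup.eq_one_iff] at hq)] at hc
    refine LinearMap.ext fun a => ?_
    obtain ⟨x, rfl⟩ := hP.surjective a
    rw [← hcd, show c = 0 from hc, LinearMap.zero_apply, map_zero, LinearMap.zero_apply]

end IsCover

end Cover

end GradedAlg

namespace GradedAlg

variable {F : Type u} [Field F] {G : Type v} [CommGroup G]

/-! ## Loop algebras as coverings -/

section LoopCover

variable {H : Subgroup G} (A : GradedAlg.{u, v, w} F (G ⧸ H))

/-- The projection `L_π(A) → A`, `a ⊗ g ↦ a`. -/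
def loopProj : A.loop.carrier →ₗ[F] A.carrier :=
  (TensorProduct.rid F A.carrier).toLinearMap ∘ₗ
    LinearMap.lTensor A.carrier (MonoidAlgebra.lift F F G (1 : G →* F)).toLinearMap ∘ₗ
      A.loopSpace.subtype

variable {A} in
theorem loopProj_eq {z : A.loop.carrier} {a : A.carrier} {g : G}
    (h : a ⊗ₜ MonoidAlgebra.of F G g = z.1) : A.loopProj z = a := by
  change TensorProduct.rid F A.carrier (LinearMap.lTensor A.carrier
    (MonoidAlgebra.lift F F G (1 : G →* F)).toLinearMap z.1) = a
  rw [← h]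
  simp

theorem isCover_loop : IsCover A.loop A A.loopProj := by
  have hdeg : ∀ g, ∀ z ∈ A.loop.deg g, ∃ a ∈ A.deg (g : G ⧸ H),
      a ⊗ₜ MonoidAlgebra.of F G g = z.1 := fun g z hz => hz
  refine ⟨fun z z' => ?_, fun g z hz => ?_, fun g z hz h0 => ?_, fun g a ha => ?_⟩
  · have : A.loop.mul.compr₂ A.loopProj = A.mul.compl₁₂ A.loopProj A.loopProj := by
      refine A.loop.bilin_ext fun g k z hz z' hz' => ?_
      obtain ⟨a, -, h⟩ := hdeg g z hz
      obtain ⟨b, -, h'⟩ := hdeg k z' hz'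
      rw [LinearMap.compr₂_apply, LinearMap.compl₁₂_apply, loopProj_eq h, loopProj_eq h']
      refine loopProj_eq (g := g * k) ?_
      change _ = A.tensorMul z.1 z'.1
      rw [← h, ← h']
      simp [tensorMul]
    exact LinearMap.congr_fun₂ this z z'
  · obtain ⟨a, ha, h⟩ := hdeg g z hz
    rwa [loopProj_eq h]
  · obtain ⟨a, ha, h⟩ := hdeg g z hz
    rw [loopProj_eq h] at h0
    rw [h0, TensorProduct.zero_tmul] at h
    exact Subtype.ext h.symm
  · have hm : a ⊗ₜ MonoidAlgebra.of F G g ∈ A.loopDeg g := ⟨a, ha, rfl⟩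
    exact ⟨⟨_, le_iSup A.loopDeg g hm⟩, hm, loopProj_eq rfl⟩

end LoopCover

/-! ## Quotients by an action of `H` in the centroid -/

section Descent

/-- An action of `H` on `B` by homogeneous elements of the centroid of the same degree exhibits `B`
as a loop algebra. -/
theorem exists_isCover (B : GradedAlg.{u, v, w} F G) (H : Subgroup G)
    (ρ : H → Module.End F B.carrier) (hρ : ∀ h : H, ρ h ∈ B.centroidDeg (h : G))
    (hmul : ∀ h k, ρ h * ρ k = ρ (h * k)) (hone : ρ 1 = 1) :
    ∃ (A : GradedAlg.{u, v, w} F (G ⧸ H)) (P : B.carrier →ₗ[F] A.carrier), IsCover B A P := by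
  let s : G ⧸ H → G := fun q => q.out
  have hs : ∀ q, (s q : G ⧸ H) = q := fun q => q.out_eq'
  let η : G → H := fun g => ⟨s g * g⁻¹, by
    rw [mul_comm]; exact QuotientGroup.eq.1 (hs g).symm⟩
  have hη : ∀ g, (η g : G) * g = s g := fun g => inv_mul_cancel_right _ _
  -- The quotient is modelled on the components at coset representatives: `P₀` moves degree `g` to
  -- `s(g)` through ρ, and the product of `W` is that of `B` brought back by `P`.
  let W : Submodule F B.carrier := ⨆ q, B.deg (s q)
  have hle : ∀ q, B.deg (s q) ≤ W := le_iSup fun q => B.deg (s q)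
  let P₀ : B.carrier →ₗ[F] B.carrier := B.glift fun g => ρ (η g) ∘ₗ (B.deg g).subtype
  have hP₀ : ∀ g, ∀ x ∈ B.deg g, P₀ x = ρ (η g) x := fun g x hx => B.glift_of_mem _ hx
  have hP₀deg : ∀ g, ∀ x ∈ B.deg g, P₀ x ∈ B.deg (s g) := fun g x hx => by
    rw [hP₀ g x hx, ← hη g]
    exact (hρ (η g)).2 g x hx
  have hP₀W : ∀ x, P₀ x ∈ W := B.hom_induction (by simp)
    (fun x y hx hy => by rw [map_add]; exact add_mem hx hy)
    fun g x hx => hle _ (hP₀deg g x hx)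
  let P : B.carrier →ₗ[F] W := P₀.codRestrict W hP₀W
  have hPval : ∀ x, (P x : B.carrier) = P₀ x := fun x => rfl
  have hPρ : ∀ h x, P (ρ h x) = P x := by
    intro h x
    refine Subtype.ext ?_
    rw [hPval, hPval]
    have : P₀ ∘ₗ ρ h = P₀ := linear_ext fun g x hx => by
      have hq : ((h * g : G) : G ⧸ H) = g := by
        rw [mul_comm, QuotientGroup.mk_mul_of_mem g h.2]
      have he : η (h * g) * h = η g := Subtype.ext (by
        change s ((h * g : G) : G ⧸ H) * (h * g)⁻¹ * h = s g * g⁻¹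
        rw [hq, mul_inv, mul_comm (h : G)⁻¹, mul_assoc, inv_mul_cancel_right])
      rw [LinearMap.comp_apply, hP₀ _ _ ((hρ h).2 g x hx), hP₀ g x hx, ← Module.End.mul_apply,
        hmul, he]
    exact LinearMap.congr_fun this x
  have hPP : ∀ g, ∀ x ∈ B.deg g, ∃ h, (P x : B.carrier) = ρ h x := fun g x hx =>
    ⟨η g, hP₀ g x hx⟩
  let m : W →ₗ[F] W →ₗ[F] W := (B.mul.domRestrict₁₂ W W).compr₂ P
  have hm : ∀ x y : W, m x y = P (B.mul x y) := fun x y => rfl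
  let A : GradedAlg.{u, v, w} F (G ⧸ H) :=
    { carrier := W
      mul := m
      deg := fun q => (B.deg (s q)).comap W.subtype
      isInternal := by
        let _ : DecidableEq (G ⧸ H) := fun a b => Classical.propDecidable (a = b)
        refine DirectSum.isInternal_submodule_of_iSupIndep_of_iSup_eq_top ?_ ?_
        · rw [iSupIndep_def]
          intro q
          rw [Submodule.disjoint_def]
          intro x hx hx'
          have hker : ⨆ r, ⨆ (_ : r ≠ q), (B.deg (s r)).comap W.subtype ≤
              LinearMap.ker (B.proj (s q) ∘ₗ W.subtype) := by
            refine iSup₂_le fun r hr y hy => ?_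
            refine B.proj_of_mem_ne (k := s r) hy fun h => hr ?_
            rw [← hs r, h, hs]
          have h0 : B.proj (s q) x.1 = 0 := hker hx'
          exact Subtype.ext ((B.proj_of_mem hx).symm.trans h0)
        · refine Submodule.map_injective_of_injective W.subtype_injective ?_
          rw [Submodule.map_iSup, Submodule.map_subtype_top]
          simp only [Submodule.map_comap_subtype, inf_eq_right.2 (hle _)]
          rfl
      mul_mem := by
        intro q r x y hx hy
        have h1 := hP₀deg _ _ (B.mul_mem hx hy)
        rw [QuotientGroup.mk_mul, hs, hs] at h1
        exact h1 }
  refine ⟨A, P, fun x y => ?_, hP₀deg, fun g x hx h0 => ?_, fun g a ha => ?_⟩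
  · have : B.mul.compr₂ P = m.compl₁₂ P P := B.bilin_ext fun g k x hx y hy => by
      rw [LinearMap.compr₂_apply, LinearMap.compl₁₂_apply, hm]
      -- The operators ρ relating `P x` to `x` and `P y` to `y` leave the product, being in the
      -- centroid, and are absorbed by `P`.
      obtain ⟨h, hh⟩ := hPP g x hx
      obtain ⟨h', hh'⟩ := hPP k y hy
      rw [hh, hh', ← ((hρ h).1 x _).1, hPρ, ← ((hρ h').1 x y).2, hPρ]
    exact LinearMap.congr_fun₂ this x y
  · have h1 : ρ (η g) x = 0 := by
      rw [← hP₀ g x hx, ← hPval]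
      exact congrArg Subtype.val h0
    have h2 : ρ ((η g)⁻¹ * η g) x = 0 := by
      rw [← hmul, Module.End.mul_apply, h1, map_zero]
    rw [inv_mul_cancel, hone] at h2
    exact h2
  · have ha' : a.1 ∈ B.deg (s g) := ha
    have hmem : ρ (η g)⁻¹ a.1 ∈ B.deg g := by
      have := (hρ (η g)⁻¹).2 _ _ ha'
      rwa [← hη g, Subgroup.coe_inv, inv_mul_cancel_left] at this
    refine ⟨_, hmem, Subtype.ext ?_⟩
    rw [hPval, hP₀ g _ hmem, ← Module.End.mul_apply, hmul, mul_inv_cancel, hone]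
    rfl

/-- The classes `u_h ∈ C(B)_h` may be normalized so that they multiply by the restriction of a
symmetric cocycle on `G`. -/
theorem IsGradedCentralSimple.exists_centroid_cocycle {B : GradedAlg.{u, v, w} F G}
    (hB : B.IsGradedCentralSimple) {H : Subgroup G} (hH : ∀ h : H, B.centroidDeg (h : G) ≠ ⊥) :
    ∃ (τ : Z2sym G Fˣ) (c : H → Module.End F B.carrier), (∀ h : H, c h ∈ B.centroidDeg (h : G)) ∧
      (∀ h, c h ≠ 0) ∧ ∀ h k : H, c h * c k = (τ.1 h k : F) • c (h * k) := by
  choose c hc hc0 using fun h : H => (Submodule.ne_bot_iff _).1 (hH h)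
  have hex : ∀ h k : H, ∃ r : Fˣ, c h * c k = (r : F) • c (h * k) := by
    intro h k
    obtain ⟨r, hr⟩ := hB.exists_eq_smul (mul_mem_centroidDeg (hc h) (hc k)) (hc (h * k))
      (hc0 (h * k))
    refine ⟨Units.mk0 r ?_, hr⟩
    rintro rfl
    rw [zero_smul] at hr
    exact hB.1.mul_ne_zero (hc h) (hc0 h) (hc0 k) hr
  choose σ hσ using hex
  have hcancel : ∀ (h : H) (r t : Fˣ), (r : F) • c h = (t : F) • c h → r = t := fun h r t e =>
    Units.ext (smul_left_injective F (hc0 h) e)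
  -- Associativity of composition gives the cocycle identity, commutativity of the centroid the
  -- symmetry.
  have hσZ : (∀ a b d, σ a b * σ (a * b) d = σ a (b * d) * σ b d) ∧ ∀ a b, σ a b = σ b a := by
    refine ⟨fun a b d => hcancel (a * b * d) _ _ ?_, fun a b => hcancel (a * b) _ _ ?_⟩
    · rw [Units.val_mul, mul_smul, ← hσ, ← smul_mul_assoc, ← hσ, mul_assoc, hσ b d,
        mul_smul_comm, hσ a, smul_smul, mul_comm (σ b d : F), Units.val_mul, mul_assoc a]
    · rw [← hσ, mul_comm a, ← hσ, centroid_mul_comm hB.1.2.1 (hc a).1 (hc b).1]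
  -- The extension restricts to σ only up to `dm`; rescaling `c h` by `m h` absorbs the difference.
  obtain ⟨τ, m, hτ⟩ := Z2sym.exists_extension H (⟨σ, hσZ⟩ : Z2sym H Fˣ)
  refine ⟨τ, fun h => (m h : F) • c h, fun h => Submodule.smul_mem _ _ (hc h),
    fun h => smul_ne_zero (m h).ne_zero (hc0 h), fun h k => ?_⟩
  rw [smul_mul_smul_comm, hσ, smul_smul, smul_smul, hτ, ← Units.val_mul, ← Units.val_mul,
    ← Units.val_mul]
  congr 2
  rw [← mul_assoc, inv_mul_cancel_right, mul_comm]

/-- Every graded-central-simple algebra is a twisted loop algebra. -/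
theorem IsGradedCentralSimple.exists_twistedLoop {B : GradedAlg.{u, v, max u v w} F G}
    (hB : B.IsGradedCentralSimple) :
    ∃ (H : Subgroup G) (τ : Z2sym G Fˣ) (A : GradedAlg.{u, v, max u v w} F (G ⧸ H)),
      A.IsCentralSimple ∧ (A.twistedLoop τ).GradedIso B := by
  let H := centroidSupport hB.1
  obtain ⟨τ, c, hc, hc0, hmul⟩ := hB.exists_centroid_cocycle (H := H) fun h => h.2
  -- After this twist the factor set of the transported `c h` is τ⁻¹τ = 1.
  let e := B.toTwist τ⁻¹
  have he : IsTwist τ⁻¹ B (B.twist τ⁻¹) e := B.isTwist_toTwist τ⁻¹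
  have hB' := he.isGradedCentralSimple hB
  let ρ : H → Module.End F (B.twist τ⁻¹).carrier := fun h => twistEnd e τ⁻¹ h (c h)
  have hρ : ∀ h : H, ρ h ∈ (B.twist τ⁻¹).centroidDeg (h : G) := fun h => he.twistEnd_mem (hc h)
  have hρmul : ∀ h k, ρ h * ρ k = ρ (h * k) := fun h k => by
    refine (he.twistEnd_mul h (c h) (hc k)).trans (linear_ext fun g => he.forall_mem ?_)
    intro x hx
    rw [LinearMap.smul_apply, IsTwist.twistEnd_of_mem _ _ _ _ hx, hmul, LinearMap.smul_apply,
      map_smul, smul_comm, smul_smul, smul_smul]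
    have h1 : ((τ⁻¹ : Z2sym G Fˣ).1 h k : F) * (τ.1 h k : F) = 1 := (τ.1 h k).inv_mul
    rw [mul_assoc, h1, mul_one]
    exact (IsTwist.twistEnd_of_mem e τ⁻¹ _ _ hx).symm
  -- `ρ 1` is idempotent and injective.
  have hρ1 : ρ 1 = 1 := by
    have hinj := (hB'.1.bijective_of_ne_zero (hρ 1) (IsTwist.twistEnd_ne_zero _ _ _ (hc0 1))).1
    refine LinearMap.ext fun x => hinj ?_
    rw [← Module.End.mul_apply, hρmul, mul_one, Module.End.one_apply]
  obtain ⟨A, P, hP⟩ := exists_isCover _ H ρ hρ hρmul hρ1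
  refine ⟨H, τ, A, hP.isCentralSimple hB' fun g hg => ?_, ?_⟩
  · exact he.symm.centroidDeg_eq_bot (not_not.1 hg)
  · obtain ⟨f, hf⟩ := (hP.gradedIso A.isCover_loop).exists_isTwist
    have h := (he.trans hf).trans (A.loop.isTwist_toTwist τ)
    rw [mul_one, inv_mul_cancel] at h
    exact h.gradedIso.symm

end Descent

/-! ## Isomorphisms of twisted loop algebras -/

section Isomorphism

variable {H : Subgroup G}

/-- Transport along `e` carries the first deck action to multiples `m(h)` of the second, whence τ =
dm on `H`. Splitting off dγ with γ extending `m` leaves an inflated cocycle μ, and the rescaled map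
γ⁻¹ · (P₂ ∘ e) is invariant under the deck transformations, so it descends to `A₁ → A₂`. -/
theorem IsCover.exists_twist_gradedIso {B₁ B₂ : GradedAlg.{u, v, w} F G}
    {A₁ A₂ : GradedAlg.{u, v, x} F (G ⧸ H)} {P₁ : B₁.carrier →ₗ[F] A₁.carrier}
    {P₂ : B₂.carrier →ₗ[F] A₂.carrier} (h₁ : IsCover B₁ A₁ P₁) (h₂ : IsCover B₂ A₂ P₂)
    (hA₁ : A₁.IsCentralSimple) (hA₂ : A₂.IsCentralSimple) {τ : Z2sym G Fˣ}
    {e : B₁.carrier ≃ₗ[F] B₂.carrier} (he : IsTwist τ B₁ B₂ e) :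
    ∃ (γ : G → Fˣ) (μ : Z2sym (G ⧸ H) Fˣ),
      (∀ g k : G, τ.1 g k = γ g * γ k * (γ (g * k))⁻¹ * μ.1 g k) ∧
        (A₁.twist μ).GradedIso A₂ := by
  have hB₂ := h₂.isGradedCentralSimple hA₂
  let c : H → Module.End F B₂.carrier := fun h => twistEnd e τ h (h₁.shift h)
  have hc : ∀ h : H, c h ∈ B₂.centroidDeg (h : G) := fun h => he.twistEnd_mem (h₁.shift_mem h)
  have hc0 : ∀ h, c h ≠ 0 := fun h =>
    IsTwist.twistEnd_ne_zero _ _ _ (h₁.shift_ne_zero hA₁.1.1 h)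
  have hs0 : ∀ h, h₂.shift h ≠ 0 := h₂.shift_ne_zero hA₂.1.1
  have hcmul : ∀ h k : H, c h * c k = (τ.1 h k : F) • c (h * k) := fun h k => by
    simp only [c]
    rw [he.twistEnd_mul h _ (h₁.shift_mem k), h₁.shift_mul, Subgroup.coe_mul]
  have hex : ∀ h, ∃ r : Fˣ, c h = (r : F) • h₂.shift h := fun h => by
    obtain ⟨r, hr⟩ := hB₂.exists_eq_smul (hc h) (h₂.shift_mem h) (hs0 h)
    refine ⟨Units.mk0 r ?_, hr⟩
    rintro rfl
    rw [zero_smul] at hr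
    exact hc0 h hr
  choose m hm using hex
  obtain ⟨γ, μ, hγ, hμ, hτ⟩ := Z2sym.exists_inflation H τ m fun h k => by
    have h1 := hcmul h k
    rw [hm, hm, hm, smul_mul_smul_comm, h₂.shift_mul, smul_smul, ← Units.val_mul,
      ← Units.val_mul] at h1
    rw [eq_mul_inv_iff_mul_eq]
    exact (Units.ext (smul_left_injective F (hs0 (h * k)) h1)).symm
  refine ⟨γ, μ, hτ, ?_⟩
  let ψ : B₁.carrier →ₗ[F] A₂.carrier := B₁.glift fun g =>
    (((γ g)⁻¹ : Fˣ) : F) • (P₂ ∘ₗ e.toLinearMap ∘ₗ (B₁.deg g).subtype)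
  have hψ : ∀ g, ∀ x ∈ B₁.deg g, ψ x = (((γ g)⁻¹ : Fˣ) : F) • P₂ (e x) :=
    fun g x hx => B₁.glift_of_mem _ hx
  obtain ⟨f, hf⟩ := h₁.exists_descent ψ fun h x => by
    have : ψ ∘ₗ h₁.shift h = ψ := linear_ext fun g x hx => by
      have h1 : c h (e x) = (τ.1 h g : F) • e (h₁.shift h x) := IsTwist.twistEnd_of_mem _ _ _ _ hx
      rw [hm, LinearMap.smul_apply] at h1
      have h2 := congrArg P₂ h1
      rw [map_smul, map_smul, h₂.apply_shift] at h2
      -- Invariance needs exactly γ = m on `H` and the normalization `μ(1, ·) = 1`.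
      have h3 : τ.1 h g = m h * γ g * (γ (h * g))⁻¹ := by
        rw [hτ, hγ, (QuotientGroup.eq_one_iff (h : G)).2 h.2, hμ, mul_one]
      rw [LinearMap.comp_apply, hψ _ _ ((h₁.shift_mem h).2 g x hx), hψ g x hx]
      have h4 := congrArg (fun z => (((m h * γ g)⁻¹ : Fˣ) : F) • z) h2
      simp only [smul_smul, ← Units.val_mul] at h4
      rw [h3, ← mul_assoc, inv_mul_cancel, one_mul, mul_inv_rev, inv_mul_cancel_right] at h4
      exact h4.symm
    exact LinearMap.congr_fun this x
  let t := A₁.toTwist μ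
  have ht : IsTwist μ A₁ (A₁.twist μ) t := A₁.isTwist_toTwist μ
  have hlift : ∀ q, ∀ a ∈ A₁.deg q, ∃ g : G, (g : G ⧸ H) = q ∧ ∃ x ∈ B₁.deg g, P₁ x = a := by
    intro q a ha
    obtain ⟨g, rfl⟩ := QuotientGroup.mk_surjective q
    exact ⟨g, rfl, h₁.exists_lift g a ha⟩
  refine gradedIso_of_components (A₁.twist μ) (f ∘ₗ t.symm.toLinearMap)
    (fun q r => ht.forall_mem fun a ha => ht.forall_mem fun b hb => ?_)
    (fun q => ht.forall_mem fun a ha => ?_) (fun q => ht.forall_mem fun a ha h0 => ?_)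
    fun q b hb => ?_
  · obtain ⟨g, rfl, x, hx, rfl⟩ := hlift q a ha
    obtain ⟨k, rfl, y, hy, rfl⟩ := hlift r b hb
    rw [ht.mul_of_mem _ _ _ ha _ hb]
    simp only [LinearMap.comp_apply, LinearEquiv.coe_coe, map_smul, t.symm_apply_apply]
    rw [← h₁.map_mul, hf, hf, hf, hψ _ _ (B₁.mul_mem hx hy), hψ g x hx, hψ k y hy, map_smul,
      map_smul, LinearMap.smul_apply, ← h₂.map_mul, he.mul_of_mem g k x hx y hy, map_smul, hτ]
    simp only [smul_smul, ← Units.val_mul]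
    congr 2
    have key : ∀ {M : Type _} [AddCommGroup M] (p q r t : M),
        t + -r = -q + (-p + (p + q + -r + t)) := by intros; abel
    exact key (M := Additive Fˣ) (γ g) (γ k) (γ (g * k)) (μ.1 g k)
  · obtain ⟨g, rfl, x, hx, rfl⟩ := hlift q a ha
    rw [LinearMap.comp_apply, LinearEquiv.coe_coe, t.symm_apply_apply, hf, hψ g x hx]
    exact Submodule.smul_mem _ _ (h₂.mem g _ (he.mem hx))
  · obtain ⟨g, rfl, x, hx, rfl⟩ := hlift q a ha
    rw [LinearMap.comp_apply, LinearEquiv.coe_coe, t.symm_apply_apply, hf, hψ g x hx] at h0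
    have h1 := h₂.eq_zero g _ (he.mem hx) ((smul_eq_zero.1 h0).resolve_left (Units.ne_zero _))
    rw [e.map_eq_zero_iff.1 h1, map_zero, map_zero]
  · obtain ⟨g, rfl⟩ := QuotientGroup.mk_surjective q
    obtain ⟨z, hz, rfl⟩ := h₂.exists_lift g b hb
    have hx : (γ g : F) • e.symm z ∈ B₁.deg g := Submodule.smul_mem _ _ (he.symm_mem hz)
    refine ⟨t (P₁ ((γ g : F) • e.symm z)), ht.mem (h₁.mem g _ hx), ?_⟩
    rw [LinearMap.comp_apply, LinearEquiv.coe_coe, t.symm_apply_apply, hf, hψ g _ hx, map_smul,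
      e.apply_symm_apply, map_smul, smul_smul, Units.inv_mul, one_smul]

/-- The support of the centroid of `L_π^τ(A)` is `H`. -/
theorem IsCentralSimple.centroidDeg_twistedLoop_ne_bot {A : GradedAlg.{u, v, w} F (G ⧸ H)}
    (hA : A.IsCentralSimple) (τ : Z2sym G Fˣ) (g : G) :
    (A.twistedLoop τ).centroidDeg g ≠ ⊥ ↔ g ∈ H := by
  have ht := A.loop.isTwist_toTwist τ
  constructor
  · intro h
    by_contra hg
    exact h (ht.symm.centroidDeg_eq_bot (A.isCover_loop.centroidDeg_eq_bot hA hg))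
  · intro hg h
    exact A.isCover_loop.centroidDeg_ne_bot hA.1.1 hg (ht.centroidDeg_eq_bot h)

theorem IsCentralSimple.isGradedCentralSimple_twistedLoop {A : GradedAlg.{u, v, w} F (G ⧸ H)}
    (hA : A.IsCentralSimple) (τ : Z2sym G Fˣ) : (A.twistedLoop τ).IsGradedCentralSimple :=
  (A.loop.isTwist_toTwist τ).isGradedCentralSimple (A.isCover_loop.isGradedCentralSimple hA)

theorem GradedIso.centroidDeg_eq_bot_iff {B₁ B₂ : GradedAlg.{u, v, w} F G} (h : B₁.GradedIso B₂)
    (g : G) : B₁.centroidDeg g = ⊥ ↔ B₂.centroidDeg g = ⊥ := by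
  obtain ⟨e, he⟩ := h.exists_isTwist
  exact ⟨he.symm.centroidDeg_eq_bot, he.centroidDeg_eq_bot⟩

/-- The twist of `L_π(A₁)` by π^*μ covers `A₁^μ ≃ A₂`, hence is isomorphic to `L_π(A₂)`. The two
twisted loop algebras then differ by the twist τ₁⁻¹ · π^*μ · τ₂, a coboundary. -/
theorem twistedLoop_gradedIso {A₁ A₂ : GradedAlg.{u, v, w} F (G ⧸ H)} {τ₁ τ₂ : Z2sym G Fˣ}
    {μ : Z2sym (G ⧸ H) Fˣ} {γ : G → Fˣ}
    (hτ : ∀ g k : G, τ₁.1 g k = γ g * γ k * (γ (g * k))⁻¹ * (μ.1 g k * τ₂.1 g k))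
    (hA : (A₁.twist μ).GradedIso A₂) : (A₁.twistedLoop τ₁).GradedIso (A₂.twistedLoop τ₂) := by
  let ν := Z2sym.comap Fˣ (QuotientGroup.mk' H) μ
  obtain ⟨f, hf⟩ := hA.exists_isTwist
  have hf' := (A₁.isTwist_toTwist μ).trans hf
  rw [mul_one] at hf'
  have hcov := A₁.isCover_loop.twist (A₁.loop.isTwist_toTwist ν) hf'
  obtain ⟨e, he⟩ := (hcov.gradedIso A₂.isCover_loop).exists_isTwist
  have h := (((A₁.loop.isTwist_toTwist τ₁).symm.trans (A₁.loop.isTwist_toTwist ν)).trans he).trans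
    (A₂.loop.isTwist_toTwist τ₂)
  obtain ⟨e', he'⟩ := h.of_coboundary (τ := 1) γ⁻¹ fun g k => by
    change (τ₁.1 g k)⁻¹ * μ.1 g k * 1 * τ₂.1 g k =
      (γ g)⁻¹ * (γ k)⁻¹ * ((γ (g * k))⁻¹)⁻¹ * 1
    rw [mul_one, mul_one, mul_assoc, hτ, mul_inv, inv_mul_cancel_right, mul_inv, mul_inv]
  exact he'.gradedIso

end Isomorphism

end GradedAlg

/-! ## The classification -/

section Classification

theorem H2sym.mk_surjective {A B : Type*} [CommGroup A] [CommGroup B] :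
    Function.Surjective (H2sym.mk : Z2sym A B →* H2sym A B) :=
  QuotientGroup.mk'_surjective _

theorem H2sym.mk_eq_mk_iff {A B : Type*} [CommGroup A] [CommGroup B] {σ τ : Z2sym A B} :
    H2sym.mk σ = H2sym.mk τ ↔
      ∃ γ : A → B, ∀ a b, σ.1 a b = γ a * γ b * (γ (a * b))⁻¹ * τ.1 a b := by
  have h : H2sym.mk σ = H2sym.mk τ ↔ σ / τ ∈ (B2 A B).subgroupOf (Z2sym A B) :=
    QuotientGroup.eq_iff_div_mem
  rw [h]
  refine exists_congr fun γ => ?_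
  rw [Subgroup.coe_subtype, Subgroup.coe_div, eq_div_iff_mul_eq', funext_iff]
  refine forall_congr' fun a => ?_
  rw [funext_iff]
  refine forall_congr' fun b => ?_
  rw [eq_comm]
  rfl

variable {F : Type u} [Field F] {G : Type v} [CommGroup G]

open GradedAlg

/-- Classes inflated from `G ⧸ H` restrict trivially to `H`. -/
theorem H2sym.pullback_subtype_inflation (H : Subgroup G) (μ : Z2sym (G ⧸ H) Fˣ) :
    H2sym.pullback Fˣ H.subtype (H2sym.pullback Fˣ (QuotientGroup.mk' H) (H2sym.mk μ)) = 1 := by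
  rw [← map_one H2sym.mk]
  -- On `H` the inflated cocycle is the constant μ(1, 1), the coboundary of a constant cochain.
  refine H2sym.mk_eq_mk_iff.2 ⟨fun _ => μ.1 1 1, fun a b => ?_⟩
  change μ.1 ((a : G) : G ⧸ H) ((b : G) : G ⧸ H) = μ.1 1 1 * μ.1 1 1 * (μ.1 1 1)⁻¹ * 1
  rw [(QuotientGroup.eq_one_iff (a : G)).2 a.2, (QuotientGroup.eq_one_iff (b : G)).2 b.2,
    mul_inv_cancel_right, mul_one]

theorem LoopTriple.rel_of_gradedIso {H : Subgroup G} {τ₁ τ₂ : Z2sym G Fˣ}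
    {A₁ A₂ : GradedAlg.{u, v, max u v w} F (G ⧸ H)} (hA₁ : A₁.IsCentralSimple)
    (hA₂ : A₂.IsCentralSimple) (h : (A₁.twistedLoop τ₁).GradedIso (A₂.twistedLoop τ₂)) :
    LoopTriple.Rel.{u, v, w} ⟨H, H2sym.mk τ₁, A₁, hA₁⟩ ⟨H, H2sym.mk τ₂, A₂, hA₂⟩ := by
  obtain ⟨e, he⟩ := h.exists_isTwist
  have he' := ((A₁.loop.isTwist_toTwist τ₁).trans he).trans (A₂.loop.isTwist_toTwist τ₂).symm
  obtain ⟨γ, μ, hτ, hiso⟩ :=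
    A₁.isCover_loop.exists_twist_gradedIso A₂.isCover_loop hA₁ hA₂ he'
  have hμ : H2sym.mk τ₁ =
      H2sym.pullback Fˣ (QuotientGroup.mk' H) (H2sym.mk μ) * H2sym.mk τ₂ := by
    change _ = H2sym.mk (Z2sym.comap Fˣ (QuotientGroup.mk' H) μ * τ₂)
    refine H2sym.mk_eq_mk_iff.2 ⟨γ, fun g k => ?_⟩
    have h1 : τ₁.1 g k * 1 * (τ₂.1 g k)⁻¹ = _ := hτ g k
    rw [mul_one, mul_inv_eq_iff_eq_mul] at h1
    rw [h1, mul_assoc]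
    rfl
  refine ⟨H, _, _, A₁, A₂, hA₁, hA₂, rfl, rfl, ?_, μ, hμ, hiso⟩
  rw [hμ, map_mul, H2sym.pullback_subtype_inflation, one_mul]

theorem LoopTriple.gradedIso_of_rel {H₁ H₂ : Subgroup G} {τ₁ τ₂ : Z2sym G Fˣ}
    {A₁ : GradedAlg.{u, v, max u v w} F (G ⧸ H₁)} {A₂ : GradedAlg.{u, v, max u v w} F (G ⧸ H₂)}
    {hA₁ : A₁.IsCentralSimple} {hA₂ : A₂.IsCentralSimple}
    (h : LoopTriple.Rel.{u, v, w} ⟨H₁, H2sym.mk τ₁, A₁, hA₁⟩ ⟨H₂, H2sym.mk τ₂, A₂, hA₂⟩) :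
    (A₁.twistedLoop τ₁).GradedIso (A₂.twistedLoop τ₂) := by
  obtain ⟨H, c₁, c₂, A₁', A₂', h₁, h₂, e₁, e₂, -, μ, hμ, hA⟩ := h
  cases e₁
  cases e₂
  change _ = H2sym.mk (Z2sym.comap Fˣ (QuotientGroup.mk' H₁) μ * τ₂) at hμ
  obtain ⟨γ, hγ⟩ := H2sym.mk_eq_mk_iff.1 hμ
  exact twistedLoop_gradedIso hγ hA

theorem corollary4p4 (F : Type u) [Field F] (G : Type v) [CommGroup G] :
    ∃ Φ : TripleClasses.{u, v, w} F G → AlgClasses.{u, v, w} F G,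
      (∀ (H : Subgroup G) (τ : Z2sym G Fˣ) (A : GradedAlg.{u, v, max u v w} F (G ⧸ H))
          (hA : A.IsCentralSimple),
        ∃ hL : (A.twistedLoop τ).IsGradedCentralSimple,
          Φ (LoopTriple.toClass ⟨H, H2sym.mk τ, A, hA⟩) =
            GradedCentralSimpleAlg.toClass ⟨A.twistedLoop τ, hL⟩) ∧
      Function.Bijective Φ := by
  -- The choice of representatives is immaterial: `hΦ` evaluates Φ on an arbitrary cocycle of the
  -- class.
  let rep : H2sym G Fˣ → Z2sym G Fˣ := Function.surjInv H2sym.mk_surjective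
  have hrep : ∀ c, H2sym.mk (rep c) = c := Function.surjInv_eq H2sym.mk_surjective
  let L : LoopTriple.{u, v, w} F G → GradedCentralSimpleAlg.{u, v, w} F G := fun t =>
    ⟨t.A.twistedLoop (rep t.τ), t.centralSimple.isGradedCentralSimple_twistedLoop _⟩
  have hwd : ∀ t₁ t₂ : LoopTriple.{u, v, w} F G, t₁.Rel t₂ → (L t₁).toClass = (L t₂).toClass := by
    intro t₁ t₂ h
    refine Quotient.sound ?_
    rw [show t₁ = ⟨t₁.H, H2sym.mk (rep t₁.τ), t₁.A, t₁.centralSimple⟩ by rw [hrep],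
      show t₂ = ⟨t₂.H, H2sym.mk (rep t₂.τ), t₂.A, t₂.centralSimple⟩ by rw [hrep]] at h
    exact LoopTriple.gradedIso_of_rel h
  let Φ : TripleClasses.{u, v, w} F G → AlgClasses.{u, v, w} F G :=
    Quotient.lift (fun t => (L t).toClass) hwd
  have hΦ : ∀ (H : Subgroup G) (τ : Z2sym G Fˣ) (A : GradedAlg.{u, v, max u v w} F (G ⧸ H))
      (hA : A.IsCentralSimple), Φ (LoopTriple.toClass ⟨H, H2sym.mk τ, A, hA⟩) =
        GradedCentralSimpleAlg.toClass
          ⟨A.twistedLoop τ, hA.isGradedCentralSimple_twistedLoop τ⟩ := by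
    intro H τ A hA
    refine Quotient.sound ?_
    refine LoopTriple.gradedIso_of_rel (hA₁ := hA) (hA₂ := hA) ?_
    rw [hrep]
    exact LoopTriple.rel_equivalence.refl _
  refine ⟨Φ, fun H τ A hA => ⟨_, hΦ H τ A hA⟩, ?_, ?_⟩
  · intro a b
    refine Quotient.inductionOn₂ a b fun t₁ t₂ h => ?_
    obtain ⟨H₁, c₁, A₁, hA₁⟩ := t₁
    obtain ⟨H₂, c₂, A₂, hA₂⟩ := t₂
    obtain ⟨τ₁, rfl⟩ := H2sym.mk_surjective c₁
    obtain ⟨τ₂, rfl⟩ := H2sym.mk_surjective c₂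
    have h' := (hΦ H₁ τ₁ A₁ hA₁).symm.trans (h.trans (hΦ H₂ τ₂ A₂ hA₂))
    have hiso : (A₁.twistedLoop τ₁).GradedIso (A₂.twistedLoop τ₂) := Quotient.exact h'
    -- The subgroup is recovered as the support of the centroid, an isomorphism invariant.
    have hH : H₁ = H₂ := Subgroup.ext fun g => by
      rw [← hA₁.centroidDeg_twistedLoop_ne_bot τ₁ g, ← hA₂.centroidDeg_twistedLoop_ne_bot τ₂ g]
      exact not_congr (hiso.centroidDeg_eq_bot_iff g)
    subst hH
    exact Quotient.sound (LoopTriple.rel_of_gradedIso hA₁ hA₂ hiso)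
  · intro b
    refine Quotient.inductionOn b fun B => ?_
    obtain ⟨H, τ, A, hA, h⟩ := IsGradedCentralSimple.exists_twistedLoop.{u, v, w}
      B.gradedCentralSimple
    exact ⟨_, (hΦ H τ A hA).trans (Quotient.sound h)⟩

end Classification

end
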